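/- For $n\in\mathbb N$ let $\mathbb M_n^+$ be the set of positive semidefinite complex $n\times n$ matrices, and write $B>0$ if $B\in\mathbb M_n^+$ is positive definite. For $\alpha,z>0$ with $\alpha\neq1$ and $A,B\in\mathbb M_n^+$ with $A\ne0$ and $B>0$, put $$P_\alpha(A,B)=B^{1/2}\bigl(B^{-1/2}AB^{-1/2}\bigr)^{\alpha}B^{1/2},\qquad Q_{\alpha,z}(A,B)=\bigl(B^{\frac{1-\alpha}{2z}}A^{\frac{\alpha}{z}}B^{\frac{1-\alpha}{2z}}\bigr)^{z},$$ and define the maximal $\alpha$-Rényi divergence and the $\alpha$-$z$-Rényi divergence by $$\widehat D_\alpha(A\|B)=\frac1{\alpha-1}\log\frac{\mathrm{Tr}\,P_\alpha(A,B)}{\mathrm{Tr}\,A},\qquad D_{\alpha,z}(A\|B)=\frac1{\alpha-1}\log\frac{\mathrm{Tr}\,Q_{\alpha,z}(A,B)}{\mathrm{Tr}\,A}.$$ Let $\alpha,z>0$ with $\alpha\neq1$. (a) The following conditions are equivalent: (i) $\widehat D_\alpha(A\|B)\le D_{\alpha,z}(A\|B)$ for every $n\in\mathbb N$ and all $A,B\in\mathbb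 M_n^+$ with $A\ne0$ and $B>0$; (ii) $\alpha>1$ and $z\le\min\{\alpha/2,\alpha-1\}$. (b) The following conditions are equivalent: (i)$'$ $D_{\alpha,z}(A\|B)\le\widehat D_\alpha(A\|B)$ for every $n\in\mathbb N$ and all $A,B\in\mathbb M_n^+$ with $A\ne0$ and $B>0$; (ii)$'$ either $0<\alpha<1$ (and $z>0$ is arbitrary), or $\alpha>1$ and $z\ge\max\{\alpha/2,\alpha-1\}$. -/

import Mathlib

open scoped MatrixOrder ComplexOrder

noncomputable section

namespace RenyiComparison

/-- `P_α(A, B) = B^{1/2} (B^{-1/2} A B^{-1/2})^α B^{1/2}`. The real powers of positive semidefinite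
matrices are those of Mathlib's continuous functional calculus (`CFC.rpow`): the power acts on the
eigenvalues, and in particular `0 ^ p = 0` for `p > 0`. -/
def P {n : ℕ} (α : ℝ) (A B : Matrix (Fin n) (Fin n) ℂ) : Matrix (Fin n) (Fin n) ℂ :=
  B ^ (1 / 2 : ℝ) * (B ^ (-(1 / 2) : ℝ) * A * B ^ (-(1 / 2) : ℝ)) ^ α * B ^ (1 / 2 : ℝ)

/-- `Q_{α,z}(A, B) = (B^{(1-α)/(2z)} A^{α/z} B^{(1-α)/(2z)})^z`. -/
def Q {n : ℕ} (α z : ℝ) (A B : Matrix (Fin n) (Fin n) ℂ) : Matrix (Fin n) (Fin n) ℂ :=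
  (B ^ ((1 - α) / (2 * z)) * A ^ (α / z) * B ^ ((1 - α) / (2 * z))) ^ z

/-- The maximal `α`-Rényi divergence. The traces are those of positive semidefinite matrices, hence
real and nonnegative; they are read as real numbers through the real part. For `A ≥ 0`, `A ≠ 0`,
`B > 0` both traces are positive. -/
def maximalDiv {n : ℕ} (α : ℝ) (A B : Matrix (Fin n) (Fin n) ℂ) : ℝ :=
  1 / (α - 1) * Real.log ((P α A B).trace.re / A.trace.re)

/-- The `α`-`z`-Rényi divergence. -/
def alphaZDiv {n : ℕ} (α z : ℝ) (A B : Matrix (Fin n) (Fin n) ℂ) : ℝ :=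
  1 / (α - 1) * Real.log ((Q α z A B).trace.re / A.trace.re)

end RenyiComparison

end

/-! Sufficiency. For positive definite `A`, `B`, a trace inequality follows from weak
log-majorization of the eigenvalues. The norm of the `k`-th compound of a positive definite matrix
is its largest product of `k` eigenvalues, and compounds respect products, adjoints and real powers,
so they carry `P α A B` and `Q α z A B` to the same expressions in the compounds of `A` and `B`. It
therefore suffices to compare operator norms in a C⋆-algebra.

The norm comparisons rest on the Cordes inequality `‖a ^ θ * b ^ θ‖ ≤ ‖a * b‖ ^ θ` for `0 ≤ θ ≤ 1`,
a form of Löwner–Heinz. It makes `‖Q‖` decreasing in `z`. For `α > 1` only `z = α / 2` and `z = α -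
1` then need treatment; at each the sign of the comparison with `‖P‖` changes at `α = 2`. For `α <
1`, Cordes settles `z = α`, and an Ando–Hiai inequality for squares doubles `z` repeatedly, hence
reaches every `z`. Continuity in `A` passes to semidefinite `A`.

Necessity. Take one of `A`, `B⁻¹` diagonal and the other (a limit of) a rank one projection in
dimension two: both traces become explicit scalar functions. For `α > 1`, with diagonal `A` of
entries `t, 1` and weights `q, 1 - q`, the limit `t → 0` at `q = 1/2` detects `α - 1`, and `t → ∞`
with `q = t ^ (-s)` detects `α / 2`. For `α < 1`, a rank one `A` makes the trace of `P` strictly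
smaller than that of `Q`. -/

open scoped MatrixOrder ComplexOrder

namespace RenyiComparison

open scoped Matrix.Norms.L2Operator

/-! ### Real powers in a C⋆-algebra and the Cordes inequality. -/

section CStar

variable {𝔸 : Type*} [CStarAlgebra 𝔸] [PartialOrder 𝔸] [StarOrderedRing 𝔸]

lemma rpow_mul_rpow {a : 𝔸} (ha : IsStrictlyPositive a) (s t : ℝ) :
    a ^ s * a ^ t = a ^ (s + t) := (CFC.rpow_add ha.isUnit).symm

lemma rpow_rpow_of_isStrictlyPositive {a : 𝔸} (ha : IsStrictlyPositive a) (s t : ℝ) :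
    (a ^ s) ^ t = a ^ (s * t) := by
  rcases eq_or_ne s 0 with rfl | hs
  · rw [CFC.rpow_zero a ha.nonneg, CFC.one_rpow, zero_mul, CFC.rpow_zero a ha.nonneg]
  · exact CFC.rpow_rpow a s t hs ha

lemma sqrt_rpow_eq {a : 𝔸} (ha : IsStrictlyPositive a) (s : ℝ) :
    CFC.sqrt (a ^ s) = a ^ (s / 2) := by
  rw [CFC.sqrt_eq_rpow, rpow_rpow_of_isStrictlyPositive ha]; congr 1; ring

lemma isStrictlyPositive_conj_rpow {a b : 𝔸} (ha : IsStrictlyPositive a)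
    (hb : IsStrictlyPositive b) (t : ℝ) : IsStrictlyPositive (b ^ t * a * b ^ t) := by
  have hbt : IsStrictlyPositive (b ^ t) := hb.rpow b t
  refine (IsUnit.isStrictlyPositive ((hbt.isUnit.mul ha.isUnit).mul hbt.isUnit) ?_)
  exact hbt.nonneg.isSelfAdjoint.conjugate_nonneg ha.nonneg

lemma smul_rpow {a : 𝔸} (ha : IsStrictlyPositive a) {r : ℝ} (hr : 0 < r) (s : ℝ) :
    (r • a) ^ s = r ^ s • a ^ s := by
  have hra : 0 ≤ r • a := smul_nonneg hr.le ha.nonneg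
  have hspec : ∀ x ∈ spectrum ℝ a, 0 < x := fun x hx => ha.spectrum_pos hx
  rw [CFC.rpow_eq_cfc_real hra, CFC.rpow_eq_cfc_real ha.nonneg]
  rw [← cfc_comp_smul r (fun x : ℝ => x ^ s) a ?_, ← cfc_smul (r ^ s) (fun x : ℝ => x ^ s) a ?_]
  · refine cfc_congr fun x hx => ?_
    simp only [smul_eq_mul]
    exact Real.mul_rpow hr.le (hspec x hx).le
  · intro x hx
    exact (Real.continuousAt_rpow_const _ _ (Or.inl (hspec x hx).ne')).continuousWithinAt
  · rintro _ ⟨x, hx, rfl⟩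
    exact (Real.continuousAt_rpow_const _ _
      (Or.inl (mul_pos hr (hspec x hx)).ne')).continuousWithinAt

lemma isStrictlyPositive_smul {a : 𝔸} (ha : IsStrictlyPositive a) {r : ℝ} (hr : 0 < r) :
    IsStrictlyPositive (r • a) :=
  IsUnit.isStrictlyPositive (ha.isUnit.smul (Units.mk0 r hr.ne')) (smul_nonneg hr.le ha.nonneg)

lemma norm_mul_comm_of_nonneg {a b : 𝔸} (ha : 0 ≤ a) (hb : 0 ≤ b) :
    ‖a * b‖ = ‖b * a‖ := by
  rw [← norm_star (a * b), star_mul, ha.star_eq, hb.star_eq]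

lemma norm_conj_rpow {a b : 𝔸} (ha : IsStrictlyPositive a) (hb : IsStrictlyPositive b)
    (s t : ℝ) : ‖b ^ t * a ^ s * b ^ t‖ = ‖a ^ (s / 2) * b ^ t‖ ^ 2 := by
  rw [CFC.IsSelfAdjoint.norm_mul_mul_self_of_nonneg (b ^ t) (hb.rpow b t).nonneg.isSelfAdjoint
    CFC.rpow_nonneg, sqrt_rpow_eq ha]

/-- Löwner–Heinz in disguise: the norm bound for `a ^ s * b ^ s` is the order relation `a ^ (2 * s)
≤ b ^ (-2 * s)`, and raising the relation for `s = 1` to the power `θ` gives the one for `s = θ`. -/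
lemma norm_rpow_mul_rpow_le_one {a b : 𝔸} (ha : IsStrictlyPositive a)
    (hb : IsStrictlyPositive b) {θ : ℝ} (h0 : 0 ≤ θ) (h1 : θ ≤ 1) (h : ‖a * b‖ ≤ 1) :
    ‖a ^ θ * b ^ θ‖ ≤ 1 := by
  have key : ∀ s : ℝ, a ^ (2 * s) ≤ b ^ (-2 * s) ↔ ‖a ^ s * b ^ s‖ ≤ 1 := by
    intro s
    rw [le_iff_norm_sqrt_mul_rpow (a ^ (2 * s)) (b ^ (-2 * s)) CFC.rpow_nonneg (hb.rpow b _),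
      sqrt_rpow_eq ha, rpow_rpow_of_isStrictlyPositive hb]
    ring_nf
  have h2 := (key 1).2 (by rwa [CFC.rpow_one a ha.nonneg, CFC.rpow_one b hb.nonneg])
  have h3 := CFC.rpow_le_rpow ⟨h0, h1⟩ h2
  rw [rpow_rpow_of_isStrictlyPositive ha, rpow_rpow_of_isStrictlyPositive hb] at h3
  rw [← key]
  convert h3 using 2 <;> ring

/-- Cordes inequality. -/
lemma norm_rpow_mul_rpow_le {a b : 𝔸} (ha : IsStrictlyPositive a)
    (hb : IsStrictlyPositive b) {θ : ℝ} (h0 : 0 ≤ θ) (h1 : θ ≤ 1) :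
    ‖a ^ θ * b ^ θ‖ ≤ ‖a * b‖ ^ θ := by
  rcases subsingleton_or_nontrivial 𝔸 with h𝔸 | h𝔸
  · rw [Subsingleton.elim (a ^ θ * b ^ θ) 0, norm_zero]
    positivity
  have hpos : 0 < ‖a * b‖ := norm_pos_iff.2 (ha.isUnit.mul hb.isUnit).ne_zero
  have hr : 0 < ‖a * b‖⁻¹ := inv_pos.2 hpos
  have h := norm_rpow_mul_rpow_le_one (isStrictlyPositive_smul ha hr) hb h0 h1 (by
    rw [smul_mul_assoc, norm_smul, Real.norm_of_nonneg hr.le, inv_mul_cancel₀ hpos.ne'])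
  rw [smul_rpow ha hr, smul_mul_assoc, norm_smul, Real.norm_of_nonneg (by positivity),
    Real.inv_rpow hpos.le, inv_mul_le_iff₀ (by positivity), mul_one] at h
  exact h

lemma norm_rpow_mul_mul_rpow_mul_le {a b : 𝔸} (ha : IsStrictlyPositive a)
    (hb : IsStrictlyPositive b) {θ s t : ℝ} (h0 : 0 ≤ θ) (h1 : θ ≤ 1) :
    ‖a ^ (s * θ) * b ^ (t * θ)‖ ≤ ‖a ^ s * b ^ t‖ ^ θ := by
  have := norm_rpow_mul_rpow_le (ha.rpow a s) (hb.rpow b t) h0 h1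
  rwa [rpow_rpow_of_isStrictlyPositive ha, rpow_rpow_of_isStrictlyPositive hb] at this

lemma unitary_conj_rpow {a : 𝔸} (ha : IsStrictlyPositive a) (u : unitary 𝔸) (s : ℝ) :
    ((u : 𝔸) * a * star (u : 𝔸)) ^ s = u * a ^ s * star (u : 𝔸) := by
  have hconj : 0 ≤ (u : 𝔸) * a * star (u : 𝔸) := star_right_conjugate_nonneg ha.nonneg _
  have := StarAlgHomClass.map_cfc (Unitary.conjStarAlgAut ℝ 𝔸 u) (fun x : ℝ => x ^ s) a
    (fun x hx => (Real.continuousAt_rpow_const _ _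
      (Or.inl (ha.spectrum_pos hx).ne')).continuousWithinAt)
    (show Continuous fun x : 𝔸 => (u : 𝔸) * x * star (u : 𝔸) by fun_prop) ha.nonneg.isSelfAdjoint
    (by simpa only [Unitary.conjStarAlgAut_apply] using hconj.isSelfAdjoint)
  rw [CFC.rpow_eq_cfc_real hconj, CFC.rpow_eq_cfc_real ha.nonneg]
  simpa only [Unitary.conjStarAlgAut_apply] using this.symm

lemma isStrictlyPositive_star_mul_self {t : 𝔸} (ht : IsUnit t) :
    IsStrictlyPositive (star t * t) :=
  IsUnit.isStrictlyPositive (ht.star.mul ht) (star_mul_self_nonneg t)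

/-- Polar decomposition: with `p = star t * t`, the element `t * p ^ (-1/2)` is unitary and
conjugates `p` into `t * star t`, hence also their powers. -/
lemma mul_star_self_rpow {t : 𝔸} (ht : IsUnit t) (s : ℝ) :
    (t * star t) ^ s = t * (star t * t) ^ (s - 1) * star t := by
  have hp := isStrictlyPositive_star_mul_self ht
  set p := star t * t with hpdef
  have hq : IsStrictlyPositive (p ^ (-(1 / 2) : ℝ)) := hp.rpow p _
  have hu1 : star (t * p ^ (-(1 / 2) : ℝ)) * (t * p ^ (-(1 / 2) : ℝ)) = 1 := by
    rw [star_mul, hq.nonneg.star_eq]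
    calc _ = p ^ (-(1 / 2) : ℝ) * p * p ^ (-(1 / 2) : ℝ) := by rw [hpdef]; noncomm_ring
      _ = 1 := CFC.conjugate_rpow_neg_one_half p hp
  have hu : t * p ^ (-(1 / 2) : ℝ) ∈ unitary 𝔸 := by
    refine ⟨hu1, ?_⟩
    have hunit : IsUnit (t * p ^ (-(1 / 2) : ℝ)) := ht.mul hq.isUnit
    obtain ⟨v, hv⟩ := hunit
    rw [← hv] at hu1 ⊢
    rw [Units.mul_eq_one_iff_eq_inv.1 hu1]; simp
  have h1 := unitary_conj_rpow hp ⟨_, hu⟩ 1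
  have h2 := unitary_conj_rpow hp ⟨_, hu⟩ s
  have h3 : ∀ r : ℝ, t * p ^ (-(1 / 2) : ℝ) * p ^ r * star (t * p ^ (-(1 / 2) : ℝ)) =
      t * p ^ (r - 1) * star t := by
    intro r
    rw [star_mul, hq.nonneg.star_eq]
    calc _ = t * (p ^ (-(1 / 2) : ℝ) * p ^ r * p ^ (-(1 / 2) : ℝ)) * star t := by noncomm_ring
      _ = _ := by rw [rpow_mul_rpow hp, rpow_mul_rpow hp]; ring_nf
  simp only [h3] at h2
  rw [← h2]
  congr 1
  have h4 := h3 1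
  rw [CFC.rpow_one p hp.nonneg] at h4
  rw [h4, sub_self, CFC.rpow_zero p hp.nonneg, mul_one]

end CStar

/-! ### `P` and `Q` in a C⋆-algebra, and norm comparisons for `α > 1`. -/

section CStar

variable {𝔸 : Type*} [CStarAlgebra 𝔸] [PartialOrder 𝔸] [StarOrderedRing 𝔸]

/-- The congruence `b^{-1/2} a b^{-1/2}`. -/
noncomputable def relOp (a b : 𝔸) : 𝔸 := b ^ (-(1 / 2) : ℝ) * a * b ^ (-(1 / 2) : ℝ)

/-- The expression `P_α` in a C⋆-algebra. -/
noncomputable def cstarP (α : ℝ) (a b : 𝔸) : 𝔸 :=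
  b ^ (1 / 2 : ℝ) * (relOp a b) ^ α * b ^ (1 / 2 : ℝ)

/-- The expression `Q_{α,z}` in a C⋆-algebra. -/
noncomputable def cstarQ (α z : ℝ) (a b : 𝔸) : 𝔸 :=
  (b ^ ((1 - α) / (2 * z)) * a ^ (α / z) * b ^ ((1 - α) / (2 * z))) ^ z

variable {a b : 𝔸} {α z : ℝ}

lemma isStrictlyPositive_relOp (ha : IsStrictlyPositive a) (hb : IsStrictlyPositive b) :
    IsStrictlyPositive (relOp a b) := isStrictlyPositive_conj_rpow ha hb _

lemma isStrictlyPositive_cstarP (α : ℝ) (ha : IsStrictlyPositive a) (hb : IsStrictlyPositive b) :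
    IsStrictlyPositive (cstarP α a b) :=
  isStrictlyPositive_conj_rpow ((isStrictlyPositive_relOp ha hb).rpow _ α) hb _

lemma isStrictlyPositive_cstarQ (α z : ℝ) (ha : IsStrictlyPositive a)
    (hb : IsStrictlyPositive b) : IsStrictlyPositive (cstarQ α z a b) :=
  (isStrictlyPositive_conj_rpow (ha.rpow _ _) hb _).rpow _ z

lemma conj_relOp (hb : IsStrictlyPositive b) :
    b ^ (1 / 2 : ℝ) * relOp a b * b ^ (1 / 2 : ℝ) = a := by
  have h1 : b ^ (1 / 2 : ℝ) * b ^ (-(1 / 2) : ℝ) = 1 := CFC.rpow_mul_rpow_neg _ hb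
  have h2 : b ^ (-(1 / 2) : ℝ) * b ^ (1 / 2 : ℝ) = 1 := CFC.rpow_neg_mul_rpow _ hb
  rw [relOp]
  calc _ = (b ^ (1 / 2 : ℝ) * b ^ (-(1 / 2) : ℝ)) * a *
        (b ^ (-(1 / 2) : ℝ) * b ^ (1 / 2 : ℝ)) := by noncomm_ring
    _ = a := by rw [h1, h2, one_mul, mul_one]

lemma norm_cstarP (α : ℝ) (ha : IsStrictlyPositive a) (hb : IsStrictlyPositive b) :
    ‖cstarP α a b‖ = ‖relOp a b ^ (α / 2) * b ^ (1 / 2 : ℝ)‖ ^ 2 :=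
  norm_conj_rpow (isStrictlyPositive_relOp ha hb) hb _ _

lemma norm_cstarQ (α : ℝ) (hz : 0 < z) (ha : IsStrictlyPositive a) (hb : IsStrictlyPositive b) :
    ‖cstarQ α z a b‖ = ‖a ^ (α / (2 * z)) * b ^ ((1 - α) / (2 * z))‖ ^ (2 * z) := by
  rw [cstarQ, CFC.norm_rpow _ hz (isStrictlyPositive_conj_rpow (ha.rpow _ _) hb _).nonneg,
    norm_conj_rpow ha hb, Real.rpow_mul (norm_nonneg _), Real.rpow_two]
  congr 4
  ring_nf

/-- Cordes with `θ = z / z'`: both exponents in `norm_cstarQ` are proportional to `1 / z`. -/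
lemma norm_cstarQ_antitone (α : ℝ) {z z' : ℝ} (hz : 0 < z) (hzz' : z ≤ z')
    (ha : IsStrictlyPositive a) (hb : IsStrictlyPositive b) :
    ‖cstarQ α z' a b‖ ≤ ‖cstarQ α z a b‖ := by
  have hz' : 0 < z' := hz.trans_le hzz'
  rw [norm_cstarQ α hz ha hb, norm_cstarQ α hz' ha hb]
  have h := norm_rpow_mul_mul_rpow_mul_le (s := α / (2 * z)) (t := (1 - α) / (2 * z)) ha hb
    (div_nonneg hz.le hz'.le) ((div_le_one hz').2 hzz')
  have e : ∀ x : ℝ, x / (2 * z) * (z / z') = x / (2 * z') := fun x => by field_simp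
  rw [e, e] at h
  refine (Real.rpow_le_rpow (norm_nonneg _) h (by positivity)).trans_eq ?_
  rw [← Real.rpow_mul (norm_nonneg _)]
  congr 1
  field_simp

/-- The operator `P_α` in terms of the congruence by `a^{1/2}`. -/
lemma cstarP_eq (α : ℝ) (ha : IsStrictlyPositive a) (hb : IsStrictlyPositive b) :
    cstarP α a b = a ^ (1 / 2 : ℝ) *
      (a ^ (1 / 2 : ℝ) * b ^ (-1 : ℝ) * a ^ (1 / 2 : ℝ)) ^ (α - 1) * a ^ (1 / 2 : ℝ) := by
  have ha2 := (ha.rpow a (1 / 2)).nonneg.star_eq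
  have hb2 := (hb.rpow b (-(1 / 2))).nonneg.star_eq
  have h1 : b ^ (1 / 2 : ℝ) * b ^ (-(1 / 2) : ℝ) = 1 := CFC.rpow_mul_rpow_neg _ hb
  have h2 : b ^ (-(1 / 2) : ℝ) * b ^ (1 / 2 : ℝ) = 1 := CFC.rpow_neg_mul_rpow _ hb
  have ht : IsUnit (b ^ (-(1 / 2) : ℝ) * a ^ (1 / 2 : ℝ)) :=
    (hb.rpow b _).isUnit.mul (ha.rpow a _).isUnit
  -- Here `t = b ^ (-1/2) * a ^ (1/2)`, so `t * star t` is `relOp a b` while `star t * t` is the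
  -- congruence of `b⁻¹` by `a ^ (1/2)`.
  have h := mul_star_self_rpow ht α
  rw [star_mul, ha2, hb2] at h
  have e1 : b ^ (-(1 / 2) : ℝ) * a ^ (1 / 2 : ℝ) * (a ^ (1 / 2 : ℝ) * b ^ (-(1 / 2) : ℝ)) =
      relOp a b := by
    calc _ = b ^ (-(1 / 2) : ℝ) * (a ^ (1 / 2 : ℝ) * a ^ (1 / 2 : ℝ)) * b ^ (-(1 / 2) : ℝ) := by
          noncomm_ring
      _ = _ := by rw [rpow_mul_rpow ha, add_halves, CFC.rpow_one a ha.nonneg, relOp]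
  have e2 : a ^ (1 / 2 : ℝ) * b ^ (-(1 / 2) : ℝ) * (b ^ (-(1 / 2) : ℝ) * a ^ (1 / 2 : ℝ)) =
      a ^ (1 / 2 : ℝ) * b ^ (-1 : ℝ) * a ^ (1 / 2 : ℝ) := by
    calc _ = a ^ (1 / 2 : ℝ) * (b ^ (-(1 / 2) : ℝ) * b ^ (-(1 / 2) : ℝ)) * a ^ (1 / 2 : ℝ) := by
          noncomm_ring
      _ = _ := by rw [rpow_mul_rpow hb, show (-(1 / 2) + -(1 / 2) : ℝ) = -1 by norm_num]
  rw [e1, e2] at h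
  rw [cstarP, h]
  set g := (a ^ (1 / 2 : ℝ) * b ^ (-1 : ℝ) * a ^ (1 / 2 : ℝ)) ^ (α - 1)
  calc _ = (b ^ (1 / 2 : ℝ) * b ^ (-(1 / 2) : ℝ)) * a ^ (1 / 2 : ℝ) * g * a ^ (1 / 2 : ℝ) *
        (b ^ (-(1 / 2) : ℝ) * b ^ (1 / 2 : ℝ)) := by noncomm_ring
    _ = _ := by rw [h1, h2, one_mul, mul_one]

/-! ### The endpoint `z = α - 1`. -/

section AlphaSubOne

/-- `‖P_α‖` and `‖Q_{α, α-1}‖` in terms of `g = a^{1/2} b⁻¹ a^{1/2}`. -/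
lemma norm_cstarP_eq_and_norm_cstarQ_sub_one_eq (hα : 1 < α) (ha : IsStrictlyPositive a)
    (hb : IsStrictlyPositive b) :
    ∃ g : 𝔸, IsStrictlyPositive g ∧
      ‖cstarP α a b‖ = ‖g ^ ((α - 1) / 2) * a ^ (1 / 2 : ℝ)‖ ^ 2 ∧
      ‖cstarQ α (α - 1) a b‖ =
        ‖g ^ (1 / 2 : ℝ) * a ^ (1 / (2 * (α - 1)))‖ ^ (2 * (α - 1)) := by
  have hr : 0 < α - 1 := sub_pos.2 hα
  have hg : IsStrictlyPositive (a ^ (1 / 2 : ℝ) * b ^ (-1 : ℝ) * a ^ (1 / 2 : ℝ)) :=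
    isStrictlyPositive_conj_rpow (hb.rpow b _) ha _
  refine ⟨_, hg, ?_, ?_⟩
  · rw [cstarP_eq α ha hb, norm_conj_rpow hg ha]
  · rw [norm_cstarQ α hr ha hb, Real.rpow_mul (norm_nonneg _), Real.rpow_mul (norm_nonneg _),
      Real.rpow_two, Real.rpow_two, ← norm_conj_rpow hg ha,
      norm_mul_comm_of_nonneg (ha.rpow a _).nonneg (hb.rpow b _).nonneg,
      show (1 - α) / (2 * (α - 1)) = (-1 : ℝ) / 2 by field_simp; ring,
      ← norm_conj_rpow hb ha, CFC.rpow_one _ hg.nonneg]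
    congr 2
    have e : a ^ (α / (2 * (α - 1))) = a ^ (1 / (2 * (α - 1))) * a ^ (1 / 2 : ℝ) := by
      rw [rpow_mul_rpow ha]; congr 1; field_simp; ring
    have e' : a ^ (α / (2 * (α - 1))) = a ^ (1 / 2 : ℝ) * a ^ (1 / (2 * (α - 1))) := by
      rw [rpow_mul_rpow ha]; congr 1; field_simp; ring
    nth_rw 1 [e]
    rw [e']
    noncomm_ring

lemma norm_cstarQ_sub_one_le (hα : 2 ≤ α) (ha : IsStrictlyPositive a)
    (hb : IsStrictlyPositive b) : ‖cstarQ α (α - 1) a b‖ ≤ ‖cstarP α a b‖ := by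
  obtain ⟨g, hg, hP, hQ⟩ := norm_cstarP_eq_and_norm_cstarQ_sub_one_eq (by linarith) ha hb
  have hr : 0 < α - 1 := by linarith
  rw [hP, hQ]
  have h := norm_rpow_mul_mul_rpow_mul_le (s := (α - 1) / 2) (t := 1 / 2) (θ := 1 / (α - 1)) hg ha
    (by positivity) ((div_le_one hr).2 (by linarith))
  rw [show (α - 1) / 2 * (1 / (α - 1)) = 1 / 2 by field_simp,
    show 1 / 2 * (1 / (α - 1)) = 1 / (2 * (α - 1)) by field_simp] at h
  refine (Real.rpow_le_rpow (norm_nonneg _) h (by positivity)).trans_eq ?_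
  rw [← Real.rpow_mul (norm_nonneg _), ← Real.rpow_two]
  congr 1
  field_simp

lemma norm_cstarP_le_cstarQ_sub_one (hα : 1 < α) (hα2 : α ≤ 2) (ha : IsStrictlyPositive a)
    (hb : IsStrictlyPositive b) : ‖cstarP α a b‖ ≤ ‖cstarQ α (α - 1) a b‖ := by
  obtain ⟨g, hg, hP, hQ⟩ := norm_cstarP_eq_and_norm_cstarQ_sub_one_eq hα ha hb
  have hr : 0 < α - 1 := by linarith
  rw [hP, hQ]
  have h := norm_rpow_mul_mul_rpow_mul_le (s := 1 / 2) (t := 1 / (2 * (α - 1))) (θ := α - 1) hg ha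
    hr.le (by linarith)
  rw [show 1 / 2 * (α - 1) = (α - 1) / 2 by ring,
    show 1 / (2 * (α - 1)) * (α - 1) = 1 / 2 by field_simp] at h
  refine (pow_le_pow_left₀ (norm_nonneg _) h 2).trans_eq ?_
  rw [← Real.rpow_two, ← Real.rpow_mul (norm_nonneg _), mul_comm]

end AlphaSubOne

/-! ### The endpoint `z = α / 2`. -/

section HalfAlpha

/-- At `z = α / 2` the element `a` enters `norm_cstarQ` to the first power and can be replaced by
the congruence of `relOp a b` by `b ^ (1/2)`. -/
lemma norm_cstarQ_half (hα : 0 < α) (ha : IsStrictlyPositive a) (hb : IsStrictlyPositive b) :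
    ‖cstarQ α (α / 2) a b‖ =
      ‖b ^ (1 / 2 : ℝ) * relOp a b * b ^ (1 / α - 1 / 2)‖ ^ α := by
  rw [norm_cstarQ α (by positivity) ha hb, show 2 * (α / 2) = α by ring, div_self hα.ne',
    CFC.rpow_one a ha.nonneg]
  congr 2
  nth_rw 1 [← conj_relOp (a := a) hb]
  rw [mul_assoc, rpow_mul_rpow hb]
  congr 2
  field_simp
  ring

lemma norm_cstarQ_half_le (hα : 1 < α) (hα2 : α ≤ 2) (ha : IsStrictlyPositive a)
    (hb : IsStrictlyPositive b) : ‖cstarQ α (α / 2) a b‖ ≤ ‖cstarP α a b‖ := by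
  have hα0 : 0 < α := by linarith
  have hd := isStrictlyPositive_relOp ha hb
  rw [norm_cstarQ_half hα0 ha hb, norm_cstarP α ha hb]
  set d := relOp a b
  set x := ‖d ^ (α / 2) * b ^ (1 / 2 : ℝ)‖ with hx
  -- Splitting `d` makes the first factor have norm `x`; the exponents of the second are those of
  -- `x` times `2 / α - 1`, so Cordes bounds it and the total power of `x` is `2 / α`.
  have h1 : b ^ (1 / 2 : ℝ) * d * b ^ (1 / α - 1 / 2) =
      (b ^ (1 / 2 : ℝ) * d ^ (α / 2)) * (d ^ (1 - α / 2) * b ^ (1 / α - 1 / 2)) := by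
    calc _ = b ^ (1 / 2 : ℝ) * (d ^ (α / 2) * d ^ (1 - α / 2)) * b ^ (1 / α - 1 / 2) := by
          rw [rpow_mul_rpow hd, add_sub_cancel, CFC.rpow_one d hd.nonneg]
      _ = _ := by noncomm_ring
  have h2 : ‖b ^ (1 / 2 : ℝ) * d ^ (α / 2)‖ = x :=
    norm_mul_comm_of_nonneg (hb.rpow b _).nonneg (hd.rpow d _).nonneg
  have h3 : ‖d ^ (1 - α / 2) * b ^ (1 / α - 1 / 2)‖ ≤ x ^ (2 / α - 1) := by
    have h := norm_rpow_mul_mul_rpow_mul_le (s := α / 2) (t := 1 / 2) (θ := 2 / α - 1) hd hb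
      (sub_nonneg.2 ((one_le_div hα0).2 hα2)) (by
        rw [sub_le_iff_le_add, div_le_iff₀ hα0]; linarith)
    rwa [show α / 2 * (2 / α - 1) = 1 - α / 2 by field_simp,
      show 1 / 2 * (2 / α - 1) = 1 / α - 1 / 2 by ring] at h
  have hx0 : 0 ≤ x := norm_nonneg _
  have h4 : ‖b ^ (1 / 2 : ℝ) * d * b ^ (1 / α - 1 / 2)‖ ≤ x ^ (2 / α) := by
    rw [h1]
    refine (norm_mul_le _ _).trans ?_
    rw [h2]
    refine (mul_le_mul_of_nonneg_left h3 hx0).trans_eq ?_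
    rcases hx0.eq_or_lt with h0 | h0
    · rw [← h0, zero_mul, Real.zero_rpow (by positivity)]
    · rw [← Real.rpow_one_add' hx0 (by rw [add_sub_cancel]; positivity), add_sub_cancel]
  refine (Real.rpow_le_rpow (norm_nonneg _) h4 hα0.le).trans_eq ?_
  rw [← Real.rpow_mul hx0, div_mul_cancel₀ _ hα0.ne', Real.rpow_two]

lemma norm_cstarP_le_cstarQ_half (hα2 : 2 ≤ α) (ha : IsStrictlyPositive a)
    (hb : IsStrictlyPositive b) : ‖cstarP α a b‖ ≤ ‖cstarQ α (α / 2) a b‖ := by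
  have hα0 : 0 < α := by linarith
  have hd := isStrictlyPositive_relOp ha hb
  rw [norm_cstarQ_half hα0 ha hb, norm_cstarP α ha hb]
  set d := relOp a b
  set x := ‖d ^ (α / 2) * b ^ (1 / 2 : ℝ)‖ with hx
  -- For `α ≥ 2` the exponent `1 - α / 2` is nonpositive, so the factor is moved to the other side;
  -- Cordes with `θ = 1 - 2 / α` gives `x ≤ y * x ^ (1 - 2 / α)`.
  have h1 : (b ^ (1 / 2 : ℝ) * d * b ^ (1 / α - 1 / 2)) * (b ^ (1 / 2 - 1 / α) * d ^ (α / 2 - 1)) =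
      b ^ (1 / 2 : ℝ) * d ^ (α / 2) := by
    calc _ = b ^ (1 / 2 : ℝ) * d * (b ^ (1 / α - 1 / 2) * b ^ (1 / 2 - 1 / α)) *
            d ^ (α / 2 - 1) := by noncomm_ring
      _ = b ^ (1 / 2 : ℝ) * (d * d ^ (α / 2 - 1)) := by
          rw [rpow_mul_rpow hb, show 1 / α - 1 / 2 + (1 / 2 - 1 / α) = 0 by ring,
            CFC.rpow_zero b hb.nonneg, mul_one, mul_assoc]
      _ = _ := by
          nth_rw 1 [← CFC.rpow_one d hd.nonneg]
          rw [rpow_mul_rpow hd, add_sub_cancel]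
  have h2 : ‖b ^ (1 / 2 : ℝ) * d ^ (α / 2)‖ = x :=
    norm_mul_comm_of_nonneg (hb.rpow b _).nonneg (hd.rpow d _).nonneg
  have h3 : ‖b ^ (1 / 2 - 1 / α) * d ^ (α / 2 - 1)‖ ≤ x ^ (1 - 2 / α) := by
    rw [norm_mul_comm_of_nonneg (hb.rpow b _).nonneg (hd.rpow d _).nonneg]
    have h := norm_rpow_mul_mul_rpow_mul_le (s := α / 2) (t := 1 / 2) (θ := 1 - 2 / α) hd hb
      (sub_nonneg.2 ((div_le_one hα0).2 hα2)) (by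
        rw [sub_le_self_iff]; positivity)
    rwa [show α / 2 * (1 - 2 / α) = α / 2 - 1 by field_simp,
      show 1 / 2 * (1 - 2 / α) = 1 / 2 - 1 / α by ring] at h
  have hx0 : 0 ≤ x := norm_nonneg _
  set y := ‖b ^ (1 / 2 : ℝ) * d * b ^ (1 / α - 1 / 2)‖ with hy
  have h4 : x ≤ y * x ^ (1 - 2 / α) := by
    rw [← h2, ← h1]
    refine (norm_mul_le _ _).trans ?_
    rw [h1, h2]
    exact mul_le_mul_of_nonneg_left h3 (norm_nonneg _)
  have h5 : x ^ (2 / α) ≤ y := by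
    rcases hx0.eq_or_lt with h0 | h0
    · rw [← h0, Real.zero_rpow (by positivity)]
      exact norm_nonneg _
    · have : x = x ^ (2 / α) * x ^ (1 - 2 / α) := by
        rw [← Real.rpow_add h0, add_sub_cancel, Real.rpow_one]
      exact le_of_mul_le_mul_right (this.symm.trans_le h4) (Real.rpow_pos_of_pos h0 _)
  rw [← Real.rpow_two]
  calc x ^ (2 : ℝ) = (x ^ (2 / α)) ^ α := by
        rw [← Real.rpow_mul hx0, div_mul_cancel₀ _ hα0.ne']
    _ ≤ y ^ α := Real.rpow_le_rpow (by positivity) h5 hα0.le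

end HalfAlpha

end CStar

/-! ### Norm comparison for `α < 1` via Ando–Hiai, and the final norm inequalities. -/

section CStar

variable {𝔸 : Type*} [CStarAlgebra 𝔸] [PartialOrder 𝔸] [StarOrderedRing 𝔸]
variable {a b : 𝔸} {α z : ℝ}

lemma rpow_le_rpow_of_neg {s : ℝ} (hs : s ∈ Set.Icc (-1) 0) (ha : IsStrictlyPositive a)
    (hab : a ≤ b) : b ^ s ≤ a ^ s := by
  have hb : IsStrictlyPositive b := ha.of_le hab
  have h := CStarAlgebra.rpow_neg_one_le_rpow_neg_one
    (CFC.rpow_le_rpow (p := -s) ⟨by linarith [hs.2], by linarith [hs.1]⟩ hab) (ha.rpow a _)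
  rw [rpow_rpow_of_isStrictlyPositive ha, rpow_rpow_of_isStrictlyPositive hb] at h
  simpa using h

lemma norm_cstarP_le_one_iff (α : ℝ) (ha : IsStrictlyPositive a) (hb : IsStrictlyPositive b) :
    ‖cstarP α a b‖ ≤ 1 ↔ relOp a b ^ α ≤ b ^ (-1 : ℝ) := by
  have hd := isStrictlyPositive_relOp ha hb
  rw [norm_cstarP α ha hb, le_iff_norm_sqrt_mul_rpow (relOp a b ^ α) (b ^ (-1 : ℝ))
    CFC.rpow_nonneg (hb.rpow b _), sqrt_rpow_eq hd, rpow_rpow_of_isStrictlyPositive hb,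
    sq_le_one_iff₀ (norm_nonneg _)]
  norm_num

lemma conj_rpow_le {a c : 𝔸} (b : 𝔸) (s : ℝ) (h : a ≤ c) :
    b ^ s * a * b ^ s ≤ b ^ s * c * b ^ s :=
  IsSelfAdjoint.conjugate_le_conjugate h (CFC.rpow_nonneg (a := b)).isSelfAdjoint

/-- The Ando–Hiai inequality for squares. -/
lemma norm_cstarP_sq_le_one (hα : 0 < α) (hα1 : α < 1) (ha : IsStrictlyPositive a)
    (hb : IsStrictlyPositive b) (h : ‖cstarP α a b‖ ≤ 1) :
    ‖cstarP α (a ^ (2 : ℝ)) (b ^ (2 : ℝ))‖ ≤ 1 := by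
  have hd := isStrictlyPositive_relOp ha hb
  rw [norm_cstarP_le_one_iff α ha hb] at h
  rw [norm_cstarP_le_one_iff α (ha.rpow a 2) (hb.rpow b 2)]
  have hrel : relOp (a ^ (2 : ℝ)) (b ^ (2 : ℝ)) = b ^ (-(1 / 2) : ℝ) *
      (relOp a b ^ (1 : ℝ) * b * relOp a b ^ (1 : ℝ)) * b ^ (-(1 / 2) : ℝ) := by
    rw [relOp, rpow_rpow_of_isStrictlyPositive hb, show (2 * -(1 / 2) : ℝ) = -(1 / 2) + -(1 / 2) by norm_num,
      ← rpow_mul_rpow hb, show (2 : ℝ) = 1 + 1 by norm_num, ← rpow_mul_rpow ha,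
      CFC.rpow_one a ha.nonneg, CFC.rpow_one _ hd.nonneg, relOp]
    norm_num only
    have : b ^ (-(1 / 2) : ℝ) * b * b ^ (-(1 / 2) : ℝ) = 1 := CFC.conjugate_rpow_neg_one_half b hb
    calc _ = b ^ (-(1 / 2) : ℝ) * b ^ (-(1 / 2) : ℝ) * a * 1 * a *
          b ^ (-(1 / 2) : ℝ) * b ^ (-(1 / 2) : ℝ) := by noncomm_ring
      _ = _ := by rw [← this]; noncomm_ring
  rw [hrel]
  set d := relOp a b
  -- The hypothesis `d ^ α ≤ b⁻¹` is used in several guises; here inverted, to replace the middle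
  -- `b` in `hrel` by a power of `d`.
  have hbinv : b ≤ d ^ (-α) := by
    have := rpow_le_rpow_of_neg (s := -1) ⟨le_rfl, by norm_num⟩ (hd.rpow d α) h
    rwa [rpow_rpow_of_isStrictlyPositive hb, rpow_rpow_of_isStrictlyPositive hd, neg_one_mul, neg_neg, CFC.rpow_one b hb.nonneg,
      mul_neg_one] at this
  have h1 : d ^ (1 : ℝ) * b * d ^ (1 : ℝ) ≤ d ^ (2 - α) := by
    refine (conj_rpow_le d 1 hbinv).trans_eq ?_
    rw [rpow_mul_rpow hd, rpow_mul_rpow hd]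
    ring_nf
  have h2 := CFC.rpow_le_rpow ⟨hα.le, hα1.le⟩ (conj_rpow_le b (-(1 / 2)) h1)
  refine h2.trans ?_
  -- Rewriting the `α`-th power of `t * star t` through `star t * t` produces the exponent `α - 1 ∈
  -- [-1, 0]`, where the power reverses order and the lower bound `h4` becomes useful.
  have ht : IsUnit (b ^ (-(1 / 2) : ℝ) * d ^ (1 - α / 2)) :=
    (hb.rpow b _).isUnit.mul (hd.rpow d _).isUnit
  have h3 := mul_star_self_rpow ht α
  rw [star_mul, (hb.rpow b _).nonneg.star_eq, (hd.rpow d _).nonneg.star_eq] at h3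
  have e1 : b ^ (-(1 / 2) : ℝ) * d ^ (1 - α / 2) * (d ^ (1 - α / 2) * b ^ (-(1 / 2) : ℝ)) =
      b ^ (-(1 / 2) : ℝ) * d ^ (2 - α) * b ^ (-(1 / 2) : ℝ) := by
    rw [show 2 - α = (1 - α / 2) + (1 - α / 2) by ring, ← rpow_mul_rpow hd]
    noncomm_ring
  have e2 : d ^ (1 - α / 2) * b ^ (-(1 / 2) : ℝ) * (b ^ (-(1 / 2) : ℝ) * d ^ (1 - α / 2)) =
      d ^ (1 - α / 2) * b ^ (-1 : ℝ) * d ^ (1 - α / 2) := by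
    rw [show (-1 : ℝ) = -(1 / 2) + -(1 / 2) by norm_num, ← rpow_mul_rpow hb]
    noncomm_ring
  rw [e1, e2] at h3
  rw [h3]
  have h4 : d ^ (2 : ℝ) ≤ d ^ (1 - α / 2) * b ^ (-1 : ℝ) * d ^ (1 - α / 2) := by
    refine Eq.trans_le ?_ (conj_rpow_le d (1 - α / 2) h)
    rw [rpow_mul_rpow hd, rpow_mul_rpow hd]
    ring_nf
  have h5 := rpow_le_rpow_of_neg (s := α - 1) ⟨by linarith, by linarith⟩ (hd.rpow d 2) h4
  rw [rpow_rpow_of_isStrictlyPositive hd] at h5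
  set k := (d ^ (1 - α / 2) * b ^ (-1 : ℝ) * d ^ (1 - α / 2)) ^ (α - 1)
  have h6 : d ^ (1 - α / 2) * k * d ^ (1 - α / 2) ≤ b ^ (-1 : ℝ) := by
    refine (conj_rpow_le d (1 - α / 2) h5).trans (Eq.trans_le ?_ h)
    rw [rpow_mul_rpow hd, rpow_mul_rpow hd]
    ring_nf
  calc _ = b ^ (-(1 / 2) : ℝ) * (d ^ (1 - α / 2) * k * d ^ (1 - α / 2)) * b ^ (-(1 / 2) : ℝ) := by
        noncomm_ring
    _ ≤ b ^ (-(1 / 2) : ℝ) * b ^ (-1 : ℝ) * b ^ (-(1 / 2) : ℝ) :=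
        conj_rpow_le b _ h6
    _ = _ := by
        rw [rpow_mul_rpow hb, rpow_mul_rpow hb, rpow_rpow_of_isStrictlyPositive hb]
        norm_num

lemma cstarP_smul (ha : IsStrictlyPositive a) (hb : IsStrictlyPositive b) {r : ℝ} (hr : 0 < r)
    (α : ℝ) : cstarP α (r • a) b = r ^ α • cstarP α a b := by
  have : relOp (r • a) b = r • relOp a b := by simp [relOp]
  rw [cstarP, this, smul_rpow (isStrictlyPositive_relOp ha hb) hr]
  simp [cstarP]

lemma norm_cstarP_sq_le (hα : 0 < α) (hα1 : α < 1) (ha : IsStrictlyPositive a)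
    (hb : IsStrictlyPositive b) :
    ‖cstarP α (a ^ (2 : ℝ)) (b ^ (2 : ℝ))‖ ≤ ‖cstarP α a b‖ ^ 2 := by
  rcases subsingleton_or_nontrivial 𝔸 with h𝔸 | h𝔸
  · rw [Subsingleton.elim (cstarP α (a ^ (2 : ℝ)) (b ^ (2 : ℝ))) 0, norm_zero]
    positivity
  set c := ‖cstarP α a b‖ with hc
  have hc0 : 0 < c := norm_pos_iff.2 (isStrictlyPositive_cstarP α ha hb).isUnit.ne_zero
  -- `cstarP` is homogeneous of degree `α` in `a`, so this scaling of `a` alone normalises the norm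
  -- to `1`.
  set r := c ^ (-(1 / α)) with hr
  have hr0 : 0 < r := Real.rpow_pos_of_pos hc0 _
  have hrα : r ^ α = c⁻¹ := by
    rw [hr, ← Real.rpow_mul hc0.le, show -(1 / α) * α = -1 by field_simp, Real.rpow_neg_one]
  have h := norm_cstarP_sq_le_one hα hα1 (isStrictlyPositive_smul ha hr0) hb (by
    rw [cstarP_smul ha hb hr0, hrα, norm_smul, ← hc, Real.norm_of_nonneg (by positivity),
      inv_mul_cancel₀ hc0.ne'])
  rw [smul_rpow ha hr0, cstarP_smul (ha.rpow a 2) (hb.rpow b 2) (by positivity), norm_smul,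
    ← Real.rpow_mul hr0.le, mul_comm 2 α, Real.rpow_mul hr0.le, hrα,
    Real.norm_of_nonneg (by positivity), Real.inv_rpow hc0.le, Real.rpow_two,
    inv_mul_le_iff₀ (by positivity), mul_one] at h
  exact h

/-- At `z = α` the inner power of `a` is `1`, so `Q` too is expressed through `relOp a b` and `b`;
Cordes with `θ = α` finishes. -/
lemma norm_cstarP_le_cstarQ_self (hα : 0 < α) (hα1 : α < 1) (ha : IsStrictlyPositive a)
    (hb : IsStrictlyPositive b) : ‖cstarP α a b‖ ≤ ‖cstarQ α α a b‖ := by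
  have hd := isStrictlyPositive_relOp ha hb
  have hQ : ‖cstarQ α α a b‖ = ‖relOp a b ^ (1 / 2 : ℝ) * b ^ (1 / (2 * α))‖ ^ (2 * α) := by
    rw [Real.rpow_mul (norm_nonneg _), Real.rpow_two, ← norm_conj_rpow hd hb, cstarQ,
      CFC.norm_rpow _ hα (isStrictlyPositive_conj_rpow (ha.rpow _ _) hb _).nonneg, div_self hα.ne',
      CFC.rpow_one a ha.nonneg, CFC.rpow_one _ hd.nonneg]
    congr 2
    nth_rw 1 [← conj_relOp (a := a) hb]
    have e1 : b ^ (1 / (2 * α)) = b ^ ((1 - α) / (2 * α)) * b ^ (1 / 2 : ℝ) := by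
      rw [rpow_mul_rpow hb]; congr 1; field_simp; ring
    have e2 : b ^ (1 / (2 * α)) = b ^ (1 / 2 : ℝ) * b ^ ((1 - α) / (2 * α)) := by
      rw [rpow_mul_rpow hb]; congr 1; field_simp; ring
    nth_rw 1 [e1]
    rw [e2]
    noncomm_ring
  rw [norm_cstarP α ha hb, hQ]
  have h := norm_rpow_mul_mul_rpow_mul_le (s := 1 / 2) (t := 1 / (2 * α)) hd hb hα.le hα1.le
  rw [show 1 / 2 * α = α / 2 by ring, show 1 / (2 * α) * α = 1 / 2 by field_simp] at h
  refine (pow_le_pow_left₀ (norm_nonneg _) h 2).trans_eq ?_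
  rw [← Real.rpow_two, ← Real.rpow_mul (norm_nonneg _), mul_comm]

/-- Passing to square roots of `a` and `b` and squaring the norm turns the parameter `z` of `Q` into
`2 * z`, while by Ando–Hiai the same operation does not decrease `‖P‖`. -/
lemma norm_cstarP_le_cstarQ_mul_two_pow (hα : 0 < α) (hα1 : α < 1) (m : ℕ)
    (ha : IsStrictlyPositive a) (hb : IsStrictlyPositive b) :
    ‖cstarP α a b‖ ≤ ‖cstarQ α (α * 2 ^ m) a b‖ := by
  induction m generalizing a b with
  | zero => simpa using norm_cstarP_le_cstarQ_self hα hα1 ha hb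
  | succ m ih =>
    have ha2 := ha.rpow a (1 / 2)
    have hb2 := hb.rpow b (1 / 2)
    have h := norm_cstarP_sq_le hα hα1 ha2 hb2
    rw [rpow_rpow_of_isStrictlyPositive ha, rpow_rpow_of_isStrictlyPositive hb, show (1 / 2 * 2 : ℝ) = 1 by norm_num,
      CFC.rpow_one a ha.nonneg, CFC.rpow_one b hb.nonneg] at h
    refine h.trans ((pow_le_pow_left₀ (norm_nonneg _) (ih ha2 hb2) 2).trans_eq ?_)
    rw [norm_cstarQ α (by positivity) ha2 hb2, norm_cstarQ α (by positivity) ha hb,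
      ← Real.rpow_two, ← Real.rpow_mul (norm_nonneg _), rpow_rpow_of_isStrictlyPositive ha, rpow_rpow_of_isStrictlyPositive hb]
    congr 1
    · congr 3 <;> · field_simp; ring
    · ring

lemma norm_cstarP_le_cstarQ (hα : 0 < α) (hα1 : α < 1) (hz : 0 < z)
    (ha : IsStrictlyPositive a) (hb : IsStrictlyPositive b) :
    ‖cstarP α a b‖ ≤ ‖cstarQ α z a b‖ := by
  obtain ⟨m, hm⟩ := pow_unbounded_of_one_lt (z / α) one_lt_two
  rw [div_lt_iff₀' hα] at hm
  exact (norm_cstarP_le_cstarQ_mul_two_pow hα hα1 m ha hb).trans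
    (norm_cstarQ_antitone α hz hm.le ha hb)

lemma norm_cstarP_le_cstarQ_of_le_min (hα : 1 < α) (hz : 0 < z) (h : z ≤ min (α / 2) (α - 1))
    (ha : IsStrictlyPositive a) (hb : IsStrictlyPositive b) :
    ‖cstarP α a b‖ ≤ ‖cstarQ α z a b‖ := by
  rcases le_total α 2 with h2 | h2
  · exact (norm_cstarP_le_cstarQ_sub_one hα h2 ha hb).trans
      (norm_cstarQ_antitone α hz (h.trans (min_le_right _ _)) ha hb)
  · exact (norm_cstarP_le_cstarQ_half h2 ha hb).trans
      (norm_cstarQ_antitone α hz (h.trans (min_le_left _ _)) ha hb)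

lemma norm_cstarQ_le_cstarP_of_max_le (hα : 1 < α) (h : max (α / 2) (α - 1) ≤ z)
    (ha : IsStrictlyPositive a) (hb : IsStrictlyPositive b) :
    ‖cstarQ α z a b‖ ≤ ‖cstarP α a b‖ := by
  rcases le_total α 2 with h2 | h2
  · exact (norm_cstarQ_antitone α (by linarith) ((le_max_left _ _).trans h) ha hb).trans
      (norm_cstarQ_half_le hα h2 ha hb)
  · exact (norm_cstarQ_antitone α (by linarith) ((le_max_right _ _).trans h) ha hb).trans
      (norm_cstarQ_sub_one_le h2 ha hb)

end CStar

/-! ### Functional calculus of diagonal matrices. -/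

section Diagonal

variable {ι : Type*} [DecidableEq ι]

/-- The diagonal matrix with given real entries. -/
noncomputable def realDiagonal (d : ι → ℝ) : Matrix ι ι ℂ := Matrix.diagonal fun i => (d i : ℂ)

lemma isHermitian_realDiagonal (d : ι → ℝ) : (realDiagonal d).IsHermitian := by
  rw [Matrix.IsHermitian, realDiagonal, Matrix.diagonal_conjTranspose]
  congr 1
  ext i
  simp

lemma posSemidef_realDiagonal {d : ι → ℝ} (hd : ∀ i, 0 ≤ d i) : (realDiagonal d).PosSemidef := by
  rw [realDiagonal, Matrix.posSemidef_diagonal_iff]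
  intro i
  exact_mod_cast hd i

lemma posDef_realDiagonal {d : ι → ℝ} (hd : ∀ i, 0 < d i) : (realDiagonal d).PosDef := by
  rw [realDiagonal, Matrix.posDef_diagonal_iff]
  intro i
  exact_mod_cast hd i

variable [Fintype ι]

lemma cfc_realDiagonal (f : ℝ → ℝ) (d : ι → ℝ) :
    cfc f (realDiagonal d) = realDiagonal fun i => f (d i) := by
  classical
  have hfin : (spectrum ℝ (realDiagonal d)).Finite := Matrix.finite_real_spectrum
  -- Interpolating on the spectrum and on the entries together avoids having to identify the two
  -- sets.
  set s : Finset ℝ := hfin.toFinset ∪ Finset.univ.image d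
  set q : Polynomial ℝ := Lagrange.interpolate s id f
  have hq : ∀ x ∈ s, q.eval x = f x := fun x hx =>
    Lagrange.eval_interpolate_at_node f (Set.injOn_id _) hx
  have h1 : cfc f (realDiagonal d) = cfc (fun x => q.eval x) (realDiagonal d) :=
    cfc_congr fun x hx => (hq x (Finset.mem_union_left _ (hfin.mem_toFinset.2 hx))).symm
  rw [h1, cfc_polynomial q _ (isHermitian_realDiagonal d).isSelfAdjoint]
  have h2 : realDiagonal d = Matrix.diagonalAlgHom ℝ (fun i => algebraMap ℝ ℂ (d i)) := rfl
  rw [h2, Polynomial.aeval_algHom_apply]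
  change Matrix.diagonal _ = Matrix.diagonal _
  congr 1
  ext i
  have h3 := Polynomial.aeval_algHom_apply (Pi.evalAlgHom ℝ (fun _ : ι => ℂ) i)
    (fun i => algebraMap ℝ ℂ (d i)) q
  simp only [Pi.evalAlgHom_apply] at h3
  have h4 := hq (d i) (Finset.mem_union_right _ (Finset.mem_image_of_mem d (Finset.mem_univ i)))
  rw [← h3, Polynomial.aeval_algebraMap_apply, Polynomial.coe_aeval_eq_eval, h4]
  rfl

lemma realDiagonal_rpow {d : ι → ℝ} (hd : ∀ i, 0 ≤ d i) (s : ℝ) :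
    realDiagonal d ^ s = realDiagonal fun i => d i ^ s := by
  rw [CFC.rpow_eq_cfc_real (posSemidef_realDiagonal hd).nonneg, cfc_realDiagonal]

lemma exists_unitary_realDiagonal {M : Matrix ι ι ℂ} (hM : M.PosDef) :
    ∃ U : unitary (Matrix ι ι ℂ), M = U * realDiagonal hM.1.eigenvalues *
      star (U : Matrix ι ι ℂ) :=
  ⟨hM.1.eigenvectorUnitary, hM.1.spectral_theorem⟩

end Diagonal

/-! ### Compound matrices and products of eigenvalues. -/

section Compound

variable {n : ℕ} (k : ℕ)

/-- The `k`-th compound matrix, whose entries are the `k × k` minors. -/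
noncomputable def compound (M : Matrix (Fin n) (Fin n) ℂ) :
    Matrix (Set.powersetCard (Fin n) k) (Set.powersetCard (Fin n) k) ℂ :=
  LinearMap.toMatrix ((Pi.basisFun ℂ (Fin n)).exteriorPower k)
    ((Pi.basisFun ℂ (Fin n)).exteriorPower k) (exteriorPower.map k (Matrix.toLin' M))

lemma compound_one : compound k (1 : Matrix (Fin n) (Fin n) ℂ) = 1 := by
  rw [compound, Matrix.toLin'_one, exteriorPower.map_id, LinearMap.toMatrix_id]

lemma compound_mul (M N : Matrix (Fin n) (Fin n) ℂ) :
    compound k (M * N) = compound k M * compound k N := by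
  rw [compound, Matrix.toLin'_mul, exteriorPower.map_comp, LinearMap.toMatrix_comp _
    ((Pi.basisFun ℂ (Fin n)).exteriorPower k)]
  rfl

lemma compound_apply (M : Matrix (Fin n) (Fin n) ℂ) (s t : Set.powersetCard (Fin n) k) :
    compound k M s t = (Matrix.of fun i j => M (Set.powersetCard.ofFinEmbEquiv.symm s j)
      (Set.powersetCard.ofFinEmbEquiv.symm t i)).det := by
  rw [compound, LinearMap.toMatrix_apply, exteriorPower.basis_apply,
    exteriorPower.basis_repr_apply, exteriorPower.ιMulti_family, exteriorPower.map_apply_ιMulti,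
    exteriorPower.ιMultiDual_apply_ιMulti]
  congr 1
  ext i j
  simp [Matrix.toLin'_apply]

lemma compound_star (M : Matrix (Fin n) (Fin n) ℂ) :
    compound k (star M) = star (compound k M) := by
  ext s t
  rw [Matrix.star_apply, compound_apply, compound_apply, ← Matrix.det_conjTranspose]
  rfl

lemma compound_realDiagonal (d : Fin n → ℝ) :
    compound k (realDiagonal d) = realDiagonal fun s : Set.powersetCard (Fin n) k =>
      ∏ i ∈ (s : Finset (Fin n)), d i := by
  ext s t
  have hmap : exteriorPower.map k (Matrix.toLin' (realDiagonal d))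
      (exteriorPower.ιMulti_family ℂ k (Pi.basisFun ℂ (Fin n)) t) =
      (∏ i ∈ (t : Finset (Fin n)), (d i : ℂ)) •
        exteriorPower.ιMulti_family ℂ k (Pi.basisFun ℂ (Fin n)) t := by
    have hprod : ∏ i ∈ (t : Finset (Fin n)), (d i : ℂ) =
        ∏ j, (d (Set.powersetCard.ofFinEmbEquiv.symm t j) : ℂ) := by
      rw [Set.powersetCard.ofFinEmbEquiv_symm_apply]
      conv_lhs => rw [← Finset.map_orderEmbOfFin_univ t.1 t.2, Finset.prod_map]
      rfl
    rw [exteriorPower.ιMulti_family, exteriorPower.map_apply_ιMulti, hprod,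
      ← AlternatingMap.map_smul_univ]
    congr 1
    ext i j
    simp only [realDiagonal, Function.comp_apply, Pi.basisFun_apply, Matrix.toLin'_apply,
      Matrix.mulVec_diagonal, Pi.single_apply, Pi.smul_apply, smul_eq_mul]
    split_ifs with h
    · rw [h]
    · simp
  rw [compound, LinearMap.toMatrix_apply, exteriorPower.basis_apply, hmap, map_smul,
    exteriorPower.basis_repr, realDiagonal, Matrix.diagonal_apply]
  by_cases h : s = t
  · subst h; simp
  · simp [h]

lemma compound_mem_unitary {U : Matrix (Fin n) (Fin n) ℂ} (hU : U ∈ unitary (Matrix _ _ ℂ)) :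
    compound k U ∈ unitary (Matrix _ _ ℂ) := by
  rw [Unitary.mem_iff] at hU ⊢
  rw [← compound_star, ← compound_mul, ← compound_mul, hU.1, hU.2, compound_one]
  exact ⟨rfl, rfl⟩

variable {M : Matrix (Fin n) (Fin n) ℂ}

lemma compound_conj_realDiagonal (U : Matrix (Fin n) (Fin n) ℂ) (d : Fin n → ℝ) :
    compound k (U * realDiagonal d * star U) =
      compound k U * realDiagonal (fun s : Set.powersetCard (Fin n) k =>
        ∏ i ∈ (s : Finset (Fin n)), d i) * star (compound k U) := by
  rw [compound_mul, compound_mul, compound_star, compound_realDiagonal]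

lemma isUnit_compound (hM : IsUnit M) : IsUnit (compound k M) := by
  obtain ⟨N, hN⟩ := hM.exists_right_inv
  exact IsUnit.of_mul_eq_one (compound k N) (by
    rw [← compound_mul, hN, compound_one])

lemma isStrictlyPositive_compound (hM : IsStrictlyPositive M) :
    IsStrictlyPositive (compound k M) := by
  have h2 := hM.rpow M (1 / 2)
  have h : M = star (M ^ (1 / 2 : ℝ)) * M ^ (1 / 2 : ℝ) := by
    rw [h2.nonneg.star_eq, rpow_mul_rpow hM, add_halves, CFC.rpow_one M hM.nonneg]
  rw [h, compound_mul, compound_star]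
  exact isStrictlyPositive_star_mul_self (isUnit_compound k h2.isUnit)

/-- After diagonalisation this is multiplicativity of `x ↦ x ^ s` on products of positive
eigenvalues. -/
lemma compound_rpow (hM : IsStrictlyPositive M) (s : ℝ) :
    compound k (M ^ s) = compound k M ^ s := by
  have hM' := Matrix.isStrictlyPositive_iff_posDef.1 hM
  obtain ⟨U, hU⟩ := exists_unitary_realDiagonal hM'
  have hd := hM'.eigenvalues_pos
  generalize hM'.1.eigenvalues = d at hU hd
  have hD : IsStrictlyPositive (realDiagonal d) :=
    Matrix.isStrictlyPositive_iff_posDef.2 (posDef_realDiagonal hd)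
  have hd' : ∀ s : Set.powersetCard (Fin n) k, 0 < ∏ i ∈ (s : Finset (Fin n)), d i :=
    fun s => Finset.prod_pos fun i _ => hd i
  have hD' := Matrix.isStrictlyPositive_iff_posDef.2 (posDef_realDiagonal hd')
  rw [hU, unitary_conj_rpow hD U s, compound_conj_realDiagonal,
    unitary_conj_rpow hD' ⟨_, compound_mem_unitary k U.2⟩ s, realDiagonal_rpow fun i => (hd i).le,
    realDiagonal_rpow fun i => (hd' i).le, compound_conj_realDiagonal]
  simp_rw [Real.finsetProd_rpow _ _ (fun i _ => (hd i).le) s]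

lemma norm_unitary_conj {ι : Type*} [Fintype ι] [DecidableEq ι] {U : Matrix ι ι ℂ}
    (hU : U ∈ unitary (Matrix ι ι ℂ)) (D : Matrix ι ι ℂ) : ‖U * D * star U‖ = ‖D‖ := by
  rw [CStarRing.norm_mul_mem_unitary _ (Unitary.star_mem hU), CStarRing.norm_mem_unitary_mul _ hU]

lemma norm_compound_eq (hM : M.PosDef) :
    ‖compound k M‖ = ‖fun s : Set.powersetCard (Fin n) k =>
      ((∏ i ∈ (s : Finset (Fin n)), hM.1.eigenvalues i : ℝ) : ℂ)‖ := by
  obtain ⟨U, hU⟩ := exists_unitary_realDiagonal hM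
  have h : compound k M = _ :=
    (congrArg (compound k) hU).trans (compound_conj_realDiagonal k _ _)
  rw [h, norm_unitary_conj (compound_mem_unitary k U.2), realDiagonal, Matrix.l2_opNorm_diagonal]

lemma exists_prod_eigenvalues_le {N : Matrix (Fin n) (Fin n) ℂ} (hM : M.PosDef) (hN : N.PosDef)
    (h : ‖compound k M‖ ≤ ‖compound k N‖) (s : Finset (Fin n)) (hs : s.card = k) :
    ∃ t : Finset (Fin n), t.card = k ∧
      ∏ i ∈ s, hM.1.eigenvalues i ≤ ∏ i ∈ t, hN.1.eigenvalues i := by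
  have : Nonempty (Set.powersetCard (Fin n) k) := ⟨⟨s, hs⟩⟩
  obtain ⟨t, ht⟩ := Finite.exists_max fun t : Set.powersetCard (Fin n) k =>
    ∏ i ∈ (t : Finset (Fin n)), hN.1.eigenvalues i
  refine ⟨t, t.2, ?_⟩
  rw [norm_compound_eq k hM, norm_compound_eq k hN] at h
  have hpos : ∀ t : Finset (Fin n), 0 ≤ ∏ i ∈ t, hN.1.eigenvalues i := fun t =>
    Finset.prod_nonneg fun i _ => (hN.eigenvalues_pos i).le
  have h1 := norm_le_pi_norm (fun s : Set.powersetCard (Fin n) k =>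
    ((∏ i ∈ (s : Finset (Fin n)), hM.1.eigenvalues i : ℝ) : ℂ)) ⟨s, hs⟩
  rw [Complex.norm_real] at h1
  refine (Real.le_norm_self _).trans (h1.trans (h.trans ((pi_norm_le_iff_of_nonneg (hpos t)).2 ?_)))
  intro u
  rw [Complex.norm_real, Real.norm_of_nonneg (hpos u)]
  exact ht u

end Compound

/-! ### From weak log-majorization to traces. -/

section LogMajorization

lemma prod_le_prod_castLE {n : ℕ} {μ : Fin n → ℝ} (hμ : Antitone μ) (hpos : ∀ i, 0 ≤ μ i)
    {k : ℕ} (hk : k ≤ n) (t : Finset (Fin n)) (ht : t.card = k) :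
    ∏ i ∈ t, μ i ≤ ∏ j : Fin k, μ (Fin.castLE hk j) := by
  rw [← Finset.map_orderEmbOfFin_univ t ht, Finset.prod_map]
  refine Finset.prod_le_prod (fun i _ => hpos _) fun j _ => hμ ?_
  have hmono : StrictMono fun j : Fin k => t.orderEmbOfFin ht j := (t.orderEmbOfFin ht).strictMono
  change (j : ℕ) ≤ (t.orderEmbOfFin ht j : ℕ)
  obtain ⟨j, hj⟩ := j
  induction j with
  | zero => exact Nat.zero_le _
  | succ j ih =>
    have h1 := ih (by omega)
    have h2 : t.orderEmbOfFin ht ⟨j, by omega⟩ < t.orderEmbOfFin ht ⟨j + 1, hj⟩ :=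
      hmono (by simp)
    have h3 : (t.orderEmbOfFin ht ⟨j, by omega⟩ : ℕ) < t.orderEmbOfFin ht ⟨j + 1, hj⟩ := h2
    exact Nat.succ_le_of_lt ((h1 (Finset.mem_univ _)).trans_lt h3)

/-- Abel summation: an antitone nonnegative weight preserves nonnegativity of partial sums. -/
lemma sum_range_mul_nonneg {l c : ℕ → ℝ} {n : ℕ} (hl : ∀ i, i + 1 < n → l (i + 1) ≤ l i)
    (hpos : ∀ i < n, 0 ≤ l i) (hc : ∀ k ≤ n, 0 ≤ ∑ i ∈ Finset.range k, c i) :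
    0 ≤ ∑ i ∈ Finset.range n, l i * c i := by
  -- Keeping the last weight times the partial sum, instead of `0`, is what makes the induction
  -- close.
  have key : ∀ k, k + 1 ≤ n → l k * ∑ i ∈ Finset.range (k + 1), c i ≤
      ∑ i ∈ Finset.range (k + 1), l i * c i := by
    intro k
    induction k with
    | zero => simp
    | succ k ih =>
      intro hk
      rw [Finset.sum_range_succ _ (k + 1), Finset.sum_range_succ (fun i => l i * c i) (k + 1),
        mul_add]
      have h1 := mul_le_mul_of_nonneg_right (hl k hk) (hc (k + 1) (by omega))
      have h2 := ih (by omega)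
      linarith
  rcases n with _ | n
  · simp
  · exact (mul_nonneg (hpos n (by omega)) (hc _ le_rfl)).trans (key n le_rfl)

/-- Abel summation with weights `l` applied to `log m - log l`, followed by `l * log (m / l) ≤ m -
l`. Only `l` has to be sorted. -/
lemma sum_le_sum_of_log_majorized {n : ℕ} {l m : ℕ → ℝ}
    (hl : ∀ i, i + 1 < n → l (i + 1) ≤ l i) (hlpos : ∀ i < n, 0 < l i) (hmpos : ∀ i < n, 0 < m i)
    (h : ∀ k ≤ n, ∏ i ∈ Finset.range k, l i ≤ ∏ i ∈ Finset.range k, m i) :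
    ∑ i ∈ Finset.range n, l i ≤ ∑ i ∈ Finset.range n, m i := by
  have h1 : 0 ≤ ∑ i ∈ Finset.range n, l i * (Real.log (m i) - Real.log (l i)) := by
    refine sum_range_mul_nonneg hl (fun i hi => (hlpos i hi).le) fun k hk => ?_
    have hlt : ∀ i ∈ Finset.range k, i < n := fun i hi => (Finset.mem_range.1 hi).trans_le hk
    rw [Finset.sum_sub_distrib, ← Real.log_prod fun i hi => (hmpos i (hlt i hi)).ne',
      ← Real.log_prod fun i hi => (hlpos i (hlt i hi)).ne', sub_nonneg]
    exact Real.log_le_log (Finset.prod_pos fun i hi => hlpos i (hlt i hi)) (h k hk)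
  have h2 : ∑ i ∈ Finset.range n, l i * (Real.log (m i) - Real.log (l i)) ≤
      ∑ i ∈ Finset.range n, (m i - l i) := by
    refine Finset.sum_le_sum fun i hi => ?_
    have hli := hlpos i (Finset.mem_range.1 hi)
    have hmi := hmpos i (Finset.mem_range.1 hi)
    rw [← Real.log_div hmi.ne' hli.ne']
    refine (mul_le_mul_of_nonneg_left (Real.log_le_sub_one_of_pos (div_pos hmi hli))
      hli.le).trans_eq ?_
    field_simp
  rw [Finset.sum_sub_distrib] at h2
  linarith

/-- Weak log-majorization implies the inequality of the sums. -/
lemma sum_le_sum_of_exists_prod_le {n : ℕ} {l m : Fin n → ℝ} (hl : ∀ i, 0 < l i)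
    (hm : ∀ i, 0 < m i)
    (h : ∀ s : Finset (Fin n), ∃ t : Finset (Fin n), t.card = s.card ∧
      ∏ i ∈ s, l i ≤ ∏ i ∈ t, m i) : ∑ i, l i ≤ ∑ i, m i := by
  have hsort : ∀ f : Fin n → ℝ, ∃ σ : Equiv.Perm (Fin n), Antitone (f ∘ σ) := fun f =>
    ⟨Tuple.sort fun i => -f i, fun i j hij =>
      neg_le_neg_iff.1 (Tuple.monotone_sort (fun i => -f i) hij)⟩
  obtain ⟨σ, hσ⟩ := hsort l
  obtain ⟨τ, hτ⟩ := hsort m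
  rw [← Equiv.sum_comp σ l, ← Equiv.sum_comp τ m]
  -- The value `1` beyond `n` is a filler that no hypothesis or sum sees.
  set L : ℕ → ℝ := fun i => if hi : i < n then l (σ ⟨i, hi⟩) else 1 with hL
  set N : ℕ → ℝ := fun i => if hi : i < n then m (τ ⟨i, hi⟩) else 1 with hN
  have e1 : ∀ i : Fin n, l (σ i) = L i := fun i => by simp [hL]
  have e2 : ∀ i : Fin n, m (τ i) = N i := fun i => by simp [hN]
  simp_rw [e1, e2]
  rw [Fin.sum_univ_eq_sum_range, Fin.sum_univ_eq_sum_range]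
  refine sum_le_sum_of_log_majorized ?_ ?_ ?_ ?_
  · intro i hi
    simp only [hL, hi, dif_pos, (Nat.lt_succ_self i).trans hi]
    exact hσ (by simp)
  · intro i hi
    simp only [hL, hi, dif_pos, hl]
  · intro i hi
    simp only [hN, hi, dif_pos, hm]
  · intro k hk
    obtain ⟨t, ht, hle⟩ := h (Finset.univ.map
      ((Fin.castLEEmb hk).trans σ.toEmbedding))
    rw [Finset.card_map, Finset.card_univ, Fintype.card_fin] at ht
    have h3 := prod_le_prod_castLE hτ (fun i => (hm _).le) hk (t.map τ.symm.toEmbedding)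
      (by rw [Finset.card_map, ht])
    rw [Finset.prod_map] at hle h3
    simp only [Equiv.coe_toEmbedding, Function.comp_apply, Equiv.apply_symm_apply] at h3
    rw [← Fin.prod_univ_eq_prod_range, ← Fin.prod_univ_eq_prod_range]
    refine Eq.trans_le ?_ ((hle.trans h3).trans_eq ?_)
    · exact Finset.prod_congr rfl fun i _ => (e1 (Fin.castLE hk i)).symm
    · exact Finset.prod_congr rfl fun i _ => e2 (Fin.castLE hk i)

lemma trace_re_le_of_norm_compound_le {n : ℕ} {M N : Matrix (Fin n) (Fin n) ℂ}
    (hM : M.PosDef) (hN : N.PosDef) (h : ∀ k, ‖compound k M‖ ≤ ‖compound k N‖) :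
    M.trace.re ≤ N.trace.re := by
  rw [hM.1.trace_eq_sum_eigenvalues, hN.1.trace_eq_sum_eigenvalues, Complex.re_sum,
    Complex.re_sum]
  exact sum_le_sum_of_exists_prod_le hM.eigenvalues_pos hN.eigenvalues_pos fun s =>
    exists_prod_eigenvalues_le s.card hM hN (h _) s rfl

end LogMajorization

/-! ### Trace inequalities for positive definite matrices. -/

section Trace

variable {n : ℕ} {A B : Matrix (Fin n) (Fin n) ℂ}

lemma P_eq_cstarP (α : ℝ) (A B : Matrix (Fin n) (Fin n) ℂ) : P α A B = cstarP α A B := rfl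

lemma compound_P (k : ℕ) (α : ℝ) (hA : IsStrictlyPositive A) (hB : IsStrictlyPositive B) :
    compound k (P α A B) = cstarP α (compound k A) (compound k B) := by
  have h := compound_rpow k (isStrictlyPositive_relOp hA hB) α
  rw [relOp] at h
  rw [P, compound_mul, compound_mul, compound_rpow k hB, h, compound_mul, compound_mul,
    compound_rpow k hB]
  rfl

lemma compound_Q (k : ℕ) (α z : ℝ) (hA : IsStrictlyPositive A) (hB : IsStrictlyPositive B) :
    compound k (Q α z A B) = cstarQ α z (compound k A) (compound k B) := by
  rw [Q, compound_rpow k (isStrictlyPositive_conj_rpow (hA.rpow _ _) hB _), compound_mul,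
    compound_mul, compound_rpow k hB, compound_rpow k hA]
  rfl

lemma posDef_P (α : ℝ) (hA : A.PosDef) (hB : B.PosDef) : (P α A B).PosDef := by
  rw [← Matrix.isStrictlyPositive_iff_posDef] at *
  exact isStrictlyPositive_cstarP α hA hB

lemma posDef_Q (α z : ℝ) (hA : A.PosDef) (hB : B.PosDef) : (Q α z A B).PosDef := by
  rw [← Matrix.isStrictlyPositive_iff_posDef] at *
  exact isStrictlyPositive_cstarQ α z hA hB

lemma trace_P_le_trace_Q_of_lt_one {α z : ℝ} (hα : 0 < α) (hα1 : α < 1) (hz : 0 < z)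
    (hA : A.PosDef) (hB : B.PosDef) : (P α A B).trace.re ≤ (Q α z A B).trace.re := by
  refine trace_re_le_of_norm_compound_le (posDef_P α hA hB) (posDef_Q α z hA hB) fun k => ?_
  rw [← Matrix.isStrictlyPositive_iff_posDef] at hA hB
  rw [compound_P k α hA hB, compound_Q k α z hA hB]
  exact norm_cstarP_le_cstarQ hα hα1 hz (isStrictlyPositive_compound k hA)
    (isStrictlyPositive_compound k hB)

lemma trace_P_le_trace_Q_of_le_min {α z : ℝ} (hα : 1 < α) (hz : 0 < z)
    (h : z ≤ min (α / 2) (α - 1)) (hA : A.PosDef) (hB : B.PosDef) :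
    (P α A B).trace.re ≤ (Q α z A B).trace.re := by
  refine trace_re_le_of_norm_compound_le (posDef_P α hA hB) (posDef_Q α z hA hB) fun k => ?_
  rw [← Matrix.isStrictlyPositive_iff_posDef] at hA hB
  rw [compound_P k α hA hB, compound_Q k α z hA hB]
  exact norm_cstarP_le_cstarQ_of_le_min hα hz h (isStrictlyPositive_compound k hA)
    (isStrictlyPositive_compound k hB)

lemma trace_Q_le_trace_P_of_max_le {α z : ℝ} (hα : 1 < α)
    (h : max (α / 2) (α - 1) ≤ z) (hA : A.PosDef) (hB : B.PosDef) :
    (Q α z A B).trace.re ≤ (P α A B).trace.re := by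
  refine trace_re_le_of_norm_compound_le (posDef_Q α z hA hB) (posDef_P α hA hB) fun k => ?_
  rw [← Matrix.isStrictlyPositive_iff_posDef] at hA hB
  rw [compound_P k α hA hB, compound_Q k α z hA hB]
  exact norm_cstarQ_le_cstarP_of_max_le hα h (isStrictlyPositive_compound k hA)
    (isStrictlyPositive_compound k hB)

end Trace

/-! ### Continuity of powers, and powers of multiples of projections. -/

section CStar

variable {𝔸 : Type*} [CStarAlgebra 𝔸] [PartialOrder 𝔸] [StarOrderedRing 𝔸]

lemma continuousOn_rpow_of_pos {s : ℝ} (hs : 0 < s) :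
    ContinuousOn (fun a : 𝔸 => a ^ s) {a | 0 ≤ a} := by
  lift s to NNReal using hs.le
  refine (CFC.continuousOn_nnrpow (A := 𝔸) s).congr fun a _ => ?_
  exact (CFC.nnrpow_eq_rpow (by exact_mod_cast hs)).symm

lemma eq_zero_of_rpow_eq_zero {a : 𝔸} (ha : 0 ≤ a) {s : ℝ} (hs : 0 < s) (h : a ^ s = 0) :
    a = 0 := by
  have h1 := CFC.norm_rpow a hs ha
  rw [h, norm_zero] at h1
  exact norm_eq_zero.1 ((Real.rpow_eq_zero (norm_nonneg _) hs.ne').1 h1.symm)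

/-- The spectrum lies in `{0, m}`, where `x ^ s` and `m ^ (s - 1) * x` agree; `s > 0` is needed at
`x = 0`. -/
lemma rpow_of_mul_self_eq_smul {a : 𝔸} (ha : 0 ≤ a) {m : ℝ} (h : a * a = m • a) {s : ℝ}
    (hs : 0 < s) : a ^ s = m ^ (s - 1) • a := by
  have hsa := ha.isSelfAdjoint
  have hspec : ∀ x ∈ spectrum ℝ a, x * x = m * x := by
    intro x hx
    have h1 : cfc (fun x : ℝ => x * x - m * x) a = 0 := by
      rw [cfc_sub (fun x : ℝ => x * x) (fun x => m * x) a, cfc_mul (fun x : ℝ => x) (fun x => x) a,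
        cfc_const_mul m (fun x : ℝ => x) a, cfc_id' ℝ a, h, sub_self]
    have h2 := cfc_map_spectrum (fun x : ℝ => x * x - m * x) a
    rw [h1] at h2
    have h3 : x * x - m * x ∈ spectrum ℝ (0 : 𝔸) := h2 ▸ ⟨x, hx, rfl⟩
    have : Nontrivial 𝔸 := by
      by_contra hn
      rw [not_nontrivial_iff_subsingleton] at hn
      simp [spectrum.of_subsingleton] at hx
    rw [spectrum.zero_eq, Set.mem_singleton_iff] at h3
    linarith
  have e : m ^ (s - 1) • a = cfc (fun x : ℝ => m ^ (s - 1) * x) a := by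
    rw [cfc_const_mul (m ^ (s - 1)) (fun x : ℝ => x) a, cfc_id' ℝ a]
  rw [CFC.rpow_eq_cfc_real ha, e]
  refine cfc_congr fun x hx => ?_
  have hx0 := spectrum_nonneg_of_nonneg ha hx
  change x ^ s = m ^ (s - 1) * x
  rcases hx0.eq_or_lt with h0 | h0
  · rw [← h0, Real.zero_rpow hs.ne', mul_zero]
  · have : x = m := mul_right_cancel₀ h0.ne' (hspec x hx)
    rw [← this]
    nth_rw 3 [← Real.rpow_one x]
    rw [← Real.rpow_add h0, sub_add_cancel]

end CStar

/-! ### Passage to semidefinite `A`, and from divergences to traces. -/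

section Semidefinite

variable {n : ℕ} {A B : Matrix (Fin n) (Fin n) ℂ}

lemma continuousOn_P {α : ℝ} (hα : 0 < α) (B : Matrix (Fin n) (Fin n) ℂ) :
    ContinuousOn (fun A => P α A B) {A | 0 ≤ A} := by
  refine (continuousOn_const.mul ((continuousOn_rpow_of_pos hα).comp
    (f := fun A => B ^ (-(1 / 2) : ℝ) * A * B ^ (-(1 / 2) : ℝ)) ?_ ?_)).mul continuousOn_const
  · exact (continuousOn_const.mul continuousOn_id).mul continuousOn_const
  · exact fun A hA => (CFC.rpow_nonneg (a := B)).isSelfAdjoint.conjugate_nonneg hA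

lemma continuousOn_Q {α z : ℝ} (hα : 0 < α) (hz : 0 < z) (B : Matrix (Fin n) (Fin n) ℂ) :
    ContinuousOn (fun A => Q α z A B) {A | 0 ≤ A} := by
  refine (continuousOn_rpow_of_pos hz).comp
    (f := fun A => B ^ ((1 - α) / (2 * z)) * A ^ (α / z) * B ^ ((1 - α) / (2 * z))) ?_ ?_
  · exact (continuousOn_const.mul (continuousOn_rpow_of_pos (div_pos hα hz))).mul
      continuousOn_const
  · exact fun A _ => (CFC.rpow_nonneg (a := B)).isSelfAdjoint.conjugate_nonneg CFC.rpow_nonneg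

lemma posDef_add_smul_one (hA : A.PosSemidef) {ε : ℝ} (hε : 0 < ε) : (A + ε • 1).PosDef := by
  rw [← Matrix.isStrictlyPositive_iff_posDef]
  exact IsStrictlyPositive.nonneg_add hA.nonneg
    (isStrictlyPositive_smul (Matrix.isStrictlyPositive_iff_posDef.2 Matrix.PosDef.one) hε)

lemma tendsto_add_smul_one (A : Matrix (Fin n) (Fin n) ℂ) (hA : 0 ≤ A) :
    Filter.Tendsto (fun ε : ℝ => A + ε • (1 : Matrix (Fin n) (Fin n) ℂ))
      (nhdsWithin 0 (Set.Ioi 0)) (nhdsWithin A {A | 0 ≤ A}) := by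
  refine tendsto_nhdsWithin_iff.2 ⟨?_, ?_⟩
  · have : Continuous fun ε : ℝ => A + ε • (1 : Matrix (Fin n) (Fin n) ℂ) := by fun_prop
    simpa using (this.tendsto 0).mono_left nhdsWithin_le_nhds
  · filter_upwards [self_mem_nhdsWithin] with ε hε
    exact (posDef_add_smul_one (Matrix.nonneg_iff_posSemidef.1 hA) hε).posSemidef.nonneg

/-- An inequality between continuous functions extends from definite to semidefinite matrices. -/
lemma le_of_le_posDef {f g : Matrix (Fin n) (Fin n) ℂ → ℝ} (hf : ContinuousOn f {A | 0 ≤ A})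
    (hg : ContinuousOn g {A | 0 ≤ A}) (h : ∀ A, A.PosDef → f A ≤ g A) (hA : A.PosSemidef) :
    f A ≤ g A := by
  have hlim := tendsto_add_smul_one A hA.nonneg
  refine le_of_tendsto_of_tendsto ((hf A hA.nonneg).tendsto.comp hlim)
    ((hg A hA.nonneg).tendsto.comp hlim) ?_
  filter_upwards [self_mem_nhdsWithin] with ε hε
  exact h _ (posDef_add_smul_one hA hε)

lemma continuous_trace_re : Continuous fun A : Matrix (Fin n) (Fin n) ℂ => A.trace.re :=
  Complex.continuous_re.comp continuous_id.matrix_trace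

lemma trace_re_pos (hA : A.PosSemidef) (h0 : A ≠ 0) : 0 < A.trace.re := by
  have h1 := hA.trace_nonneg
  have h2 : A.trace ≠ 0 := fun h => h0 (hA.trace_eq_zero_iff.1 h)
  exact (Complex.lt_def.1 (lt_of_le_of_ne h1 h2.symm)).1

lemma trace_P_pos {α : ℝ} (hα : 0 < α) (hA : A.PosSemidef) (h0 : A ≠ 0) (hB : B.PosDef) :
    0 < (P α A B).trace.re := by
  have hB' := Matrix.isStrictlyPositive_iff_posDef.2 hB
  have hb2 : ∀ s : ℝ, IsUnit (B ^ s) := fun s => (hB'.rpow B s).isUnit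
  have hb3 : ∀ s : ℝ, IsSelfAdjoint (B ^ s) := fun s => (hB'.rpow B s).nonneg.isSelfAdjoint
  have hR : 0 ≤ relOp A B := (hb3 _).conjugate_nonneg hA.nonneg
  refine trace_re_pos (Matrix.nonneg_iff_posSemidef.1
    ((hb3 _).conjugate_nonneg CFC.rpow_nonneg)) fun h => h0 ?_
  rw [P, (hb2 _).mul_left_eq_zero, (hb2 _).mul_right_eq_zero] at h
  have h1 := eq_zero_of_rpow_eq_zero hR hα h
  rw [← conj_relOp (a := A) hB', h1]
  simp

lemma trace_Q_pos {α z : ℝ} (hα : 0 < α) (hz : 0 < z) (hA : A.PosSemidef) (h0 : A ≠ 0)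
    (hB : B.PosDef) : 0 < (Q α z A B).trace.re := by
  have hB' := Matrix.isStrictlyPositive_iff_posDef.2 hB
  have hb2 : ∀ s : ℝ, IsUnit (B ^ s) := fun s => (hB'.rpow B s).isUnit
  have hb3 : ∀ s : ℝ, IsSelfAdjoint (B ^ s) := fun s => (hB'.rpow B s).nonneg.isSelfAdjoint
  refine trace_re_pos (Matrix.nonneg_iff_posSemidef.1 CFC.rpow_nonneg) fun h => h0 ?_
  have h1 := eq_zero_of_rpow_eq_zero ((hb3 _).conjugate_nonneg CFC.rpow_nonneg) hz h
  rw [(hb2 _).mul_left_eq_zero, (hb2 _).mul_right_eq_zero] at h1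
  exact eq_zero_of_rpow_eq_zero hA.nonneg (div_pos hα hz) h1

lemma maximalDiv_le_alphaZDiv_iff {α z : ℝ} (hα : 1 < α) (hz : 0 < z) (hA : A.PosSemidef)
    (h0 : A ≠ 0) (hB : B.PosDef) :
    maximalDiv α A B ≤ alphaZDiv α z A B ↔ (P α A B).trace.re ≤ (Q α z A B).trace.re := by
  have ht := trace_re_pos hA h0
  have hP := trace_P_pos (by linarith) hA h0 hB (α := α)
  have hQ := trace_Q_pos (by linarith) hz hA h0 hB (α := α)
  rw [maximalDiv, alphaZDiv, mul_le_mul_iff_right₀ (one_div_pos.2 (sub_pos.2 hα)),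
    Real.log_le_log_iff (div_pos hP ht) (div_pos hQ ht), div_le_div_iff_of_pos_right ht]

lemma alphaZDiv_le_maximalDiv_iff {α z : ℝ} (hα : 1 < α) (hz : 0 < z) (hA : A.PosSemidef)
    (h0 : A ≠ 0) (hB : B.PosDef) :
    alphaZDiv α z A B ≤ maximalDiv α A B ↔ (Q α z A B).trace.re ≤ (P α A B).trace.re := by
  have ht := trace_re_pos hA h0
  have hP := trace_P_pos (by linarith) hA h0 hB (α := α)
  have hQ := trace_Q_pos (by linarith) hz hA h0 hB (α := α)
  rw [maximalDiv, alphaZDiv, mul_le_mul_iff_right₀ (one_div_pos.2 (sub_pos.2 hα)),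
    Real.log_le_log_iff (div_pos hQ ht) (div_pos hP ht), div_le_div_iff_of_pos_right ht]

/-- The prefactor `1 / (α - 1)` is now negative, which reverses the trace inequality. -/
lemma maximalDiv_le_alphaZDiv_iff_of_lt_one {α z : ℝ} (hα : 0 < α) (hα1 : α < 1) (hz : 0 < z)
    (hA : A.PosSemidef) (h0 : A ≠ 0) (hB : B.PosDef) :
    maximalDiv α A B ≤ alphaZDiv α z A B ↔ (Q α z A B).trace.re ≤ (P α A B).trace.re := by
  have ht := trace_re_pos hA h0
  have hP := trace_P_pos hα hA h0 hB
  have hQ := trace_Q_pos hα hz hA h0 hB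
  rw [maximalDiv, alphaZDiv, mul_le_mul_left_of_neg (one_div_neg.2 (sub_neg.2 hα1)),
    Real.log_le_log_iff (div_pos hQ ht) (div_pos hP ht), div_le_div_iff_of_pos_right ht]

lemma alphaZDiv_le_maximalDiv_iff_of_lt_one {α z : ℝ} (hα : 0 < α) (hα1 : α < 1) (hz : 0 < z)
    (hA : A.PosSemidef) (h0 : A ≠ 0) (hB : B.PosDef) :
    alphaZDiv α z A B ≤ maximalDiv α A B ↔ (P α A B).trace.re ≤ (Q α z A B).trace.re := by
  have ht := trace_re_pos hA h0
  have hP := trace_P_pos hα hA h0 hB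
  have hQ := trace_Q_pos hα hz hA h0 hB
  rw [maximalDiv, alphaZDiv, mul_le_mul_left_of_neg (one_div_neg.2 (sub_neg.2 hα1)),
    Real.log_le_log_iff (div_pos hP ht) (div_pos hQ ht), div_le_div_iff_of_pos_right ht]

end Semidefinite

/-! ### Explicit traces for rank one `A` and diagonal `B`. -/

section RankOne

variable {n : ℕ}

/-- The rank one matrix `v v*` with `v = (√(p i))`. -/
noncomputable def rankOne (p : Fin n → ℝ) : Matrix (Fin n) (Fin n) ℂ :=
  Matrix.vecMulVec (fun i => (√(p i) : ℂ)) (star fun i => (√(p i) : ℂ))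

lemma posSemidef_rankOne (p : Fin n → ℝ) : (rankOne p).PosSemidef :=
  Matrix.posSemidef_vecMulVec_self_star _

lemma rankOne_mul_realDiagonal_mul_rankOne {p : Fin n → ℝ} (hp : ∀ i, 0 ≤ p i) (d : Fin n → ℝ) :
    rankOne p * realDiagonal d * rankOne p = (∑ i, p i * d i) • rankOne p := by
  ext i j
  rw [Matrix.mul_apply]
  simp only [rankOne, realDiagonal, Matrix.mul_diagonal, Matrix.vecMulVec_apply, Pi.star_apply,
    Complex.star_def, Complex.conj_ofReal, Matrix.smul_apply, Complex.real_smul,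
    Complex.ofReal_sum, Complex.ofReal_mul, Finset.sum_mul]
  refine Finset.sum_congr rfl fun k _ => ?_
  have : (p k : ℂ) = √(p k) * √(p k) := by
    rw [← Complex.ofReal_mul, Real.mul_self_sqrt (hp k)]
  rw [this]
  ring

lemma trace_realDiagonal_conj_rankOne {p : Fin n → ℝ} (hp : ∀ i, 0 ≤ p i) (d : Fin n → ℝ) :
    (realDiagonal d * rankOne p * realDiagonal d).trace.re = ∑ i, p i * (d i * d i) := by
  rw [Matrix.trace, Complex.re_sum]
  refine Finset.sum_congr rfl fun i _ => ?_
  simp only [rankOne, realDiagonal, Matrix.diag_apply, Matrix.mul_diagonal, Matrix.diagonal_mul,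
    Matrix.vecMulVec_apply, Pi.star_apply, Complex.star_def, Complex.conj_ofReal,
    ← Complex.ofReal_mul, Complex.ofReal_re]
  rw [← Real.mul_self_sqrt (hp i)]
  simp only [Real.sqrt_mul_self (Real.sqrt_nonneg _)]
  ring

lemma realDiagonal_one : realDiagonal (fun _ : Fin n => (1 : ℝ)) = 1 := by
  simp [realDiagonal]

variable {p : Fin n → ℝ}

lemma rankOne_rpow (hp : ∀ i, 0 ≤ p i) (hsum : ∑ i, p i = 1) {s : ℝ} (hs : 0 < s) :
    rankOne p ^ s = rankOne p := by
  have h := rankOne_mul_realDiagonal_mul_rankOne hp fun _ => 1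
  rw [realDiagonal_one, mul_one] at h
  simp only [mul_one, hsum] at h
  rw [rpow_of_mul_self_eq_smul (posSemidef_rankOne p).nonneg h hs, Real.one_rpow, one_smul]

lemma trace_rankOne (hp : ∀ i, 0 ≤ p i) (hsum : ∑ i, p i = 1) : (rankOne p).trace.re = 1 := by
  have h := trace_realDiagonal_conj_rankOne hp fun _ => 1
  rwa [realDiagonal_one, one_mul, mul_one, mul_one, Finset.sum_congr rfl fun i _ => mul_one (p i),
    hsum] at h

lemma rankOne_ne_zero (hp : ∀ i, 0 ≤ p i) (hsum : ∑ i, p i = 1) : rankOne p ≠ 0 := by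
  intro h
  have := trace_rankOne hp hsum
  simp [h] at this

lemma realDiagonal_mul_realDiagonal (d e : Fin n → ℝ) :
    realDiagonal d * realDiagonal e = realDiagonal fun i => d i * e i := by
  simp [realDiagonal, Matrix.diagonal_mul_diagonal]

lemma realDiagonal_conj_rankOne_rpow (hp : ∀ i, 0 ≤ p i) (d : Fin n → ℝ) {s : ℝ} (hs : 0 < s) :
    (realDiagonal d * rankOne p * realDiagonal d) ^ s =
      (∑ i, p i * (d i * d i)) ^ (s - 1) • (realDiagonal d * rankOne p * realDiagonal d) := by
  refine rpow_of_mul_self_eq_smul ?_ ?_ hs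
  · exact IsSelfAdjoint.conjugate_nonneg (posSemidef_rankOne p).nonneg
      (isHermitian_realDiagonal d).isSelfAdjoint
  · rw [← smul_mul_assoc, ← mul_smul_comm, ← rankOne_mul_realDiagonal_mul_rankOne hp,
      ← realDiagonal_mul_realDiagonal]
    noncomm_ring

lemma trace_realDiagonal_conj_rankOne_rpow (hp : ∀ i, 0 ≤ p i) {d : Fin n → ℝ}
    (hd : 0 < ∑ i, p i * (d i * d i)) {s : ℝ} (hs : 0 < s) :
    ((realDiagonal d * rankOne p * realDiagonal d) ^ s).trace.re =
      (∑ i, p i * (d i * d i)) ^ s := by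
  rw [realDiagonal_conj_rankOne_rpow hp d hs, Matrix.trace_smul, Complex.smul_re,
    trace_realDiagonal_conj_rankOne hp, smul_eq_mul]
  nth_rw 2 [← Real.rpow_one (∑ i, p i * (d i * d i))]
  rw [← Real.rpow_add hd, sub_add_cancel]

lemma trace_P_rankOne (hp : ∀ i, 0 ≤ p i) (hsum : ∑ i, p i = 1) {b : Fin n → ℝ}
    (hb : ∀ i, 0 < b i) {α : ℝ} (hα : 0 < α) :
    (P α (rankOne p) (realDiagonal b)).trace.re = (∑ i, p i * (b i)⁻¹) ^ (α - 1) := by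
  have hB := Matrix.isStrictlyPositive_iff_posDef.2 (posDef_realDiagonal hb)
  have e : ∀ i, b i ^ (-(1 / 2) : ℝ) * b i ^ (-(1 / 2) : ℝ) = (b i)⁻¹ := fun i => by
    rw [← Real.rpow_add (hb i), ← Real.rpow_neg_one]; norm_num
  have h := realDiagonal_conj_rankOne_rpow hp (fun i => b i ^ (-(1 / 2) : ℝ)) hα
  simp only [e] at h
  rw [← realDiagonal_rpow fun i => (hb i).le] at h
  rw [P, h, mul_smul_comm, smul_mul_assoc]
  have h2 := conj_relOp (a := rankOne p) hB
  rw [relOp] at h2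
  rw [h2, Matrix.trace_smul, Complex.smul_re, trace_rankOne hp hsum, smul_eq_mul, mul_one]

lemma trace_Q_rankOne (hp : ∀ i, 0 ≤ p i) (hsum : ∑ i, p i = 1) {b : Fin n → ℝ}
    (hb : ∀ i, 0 < b i) {α z : ℝ} (hα : 0 < α) (hz : 0 < z) :
    (Q α z (rankOne p) (realDiagonal b)).trace.re = (∑ i, p i * b i ^ ((1 - α) / z)) ^ z := by
  have e : ∀ i, b i ^ ((1 - α) / (2 * z)) * b i ^ ((1 - α) / (2 * z)) = b i ^ ((1 - α) / z) :=
    fun i => by rw [← Real.rpow_add (hb i)]; congr 1; field_simp; ring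
  have hpos : 0 < ∑ i, p i * b i ^ ((1 - α) / z) := by
    refine lt_of_le_of_ne (Finset.sum_nonneg fun i _ =>
      mul_nonneg (hp i) (Real.rpow_nonneg (hb i).le _)) fun h => ?_
    have h0 := (Finset.sum_eq_zero_iff_of_nonneg fun i _ =>
      mul_nonneg (hp i) (Real.rpow_nonneg (hb i).le _)).1 h.symm
    have : ∑ i, p i = 0 := Finset.sum_eq_zero fun i hi =>
      (mul_eq_zero.1 (h0 i hi)).resolve_right (Real.rpow_pos_of_pos (hb i) _).ne'
    linarith
  have h := trace_realDiagonal_conj_rankOne_rpow hp (d := fun i => b i ^ ((1 - α) / (2 * z)))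
    (by simpa only [e] using hpos) hz
  simp only [e] at h
  rw [Q, rankOne_rpow hp hsum (div_pos hα hz), realDiagonal_rpow fun i => (hb i).le, h]

end RankOne

/-! ### The limit in which `B⁻¹` degenerates to rank one. -/

section InverseContinuity

variable {n : ℕ} {A C : Matrix (Fin n) (Fin n) ℂ} {α z : ℝ}

/-- `Tr P_α(A, C⁻¹)`, in a form continuous in `C ≥ 0`. -/
noncomputable def traceInvP (α : ℝ) (A C : Matrix (Fin n) (Fin n) ℂ) : ℝ :=
  (A ^ (1 / 2 : ℝ) * (A ^ (1 / 2 : ℝ) * C * A ^ (1 / 2 : ℝ)) ^ (α - 1) *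
    A ^ (1 / 2 : ℝ)).trace.re

/-- `Tr Q_{α,z}(A, C⁻¹)`, in a form continuous in `C ≥ 0`. -/
noncomputable def traceInvQ (α z : ℝ) (A C : Matrix (Fin n) (Fin n) ℂ) : ℝ :=
  ((C ^ ((α - 1) / (2 * z)) * A ^ (α / z) * C ^ ((α - 1) / (2 * z))) ^ z).trace.re

lemma trace_P_rpow_neg_one (hA : A.PosDef) (hC : C.PosDef) :
    (P α A (C ^ (-1 : ℝ))).trace.re = traceInvP α A C := by
  rw [← Matrix.isStrictlyPositive_iff_posDef] at hA hC
  rw [P_eq_cstarP, cstarP_eq α hA (hC.rpow C _), rpow_rpow_of_isStrictlyPositive hC, traceInvP]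
  norm_num only
  rw [CFC.rpow_one C hC.nonneg]

lemma trace_Q_rpow_neg_one (hC : C.PosDef) :
    (Q α z A (C ^ (-1 : ℝ))).trace.re = traceInvQ α z A C := by
  rw [← Matrix.isStrictlyPositive_iff_posDef] at hC
  rw [Q, rpow_rpow_of_isStrictlyPositive hC, traceInvQ, show -1 * ((1 - α) / (2 * z)) = (α - 1) / (2 * z) by ring]

lemma continuousOn_traceInvP (hα : 1 < α) (A : Matrix (Fin n) (Fin n) ℂ) :
    ContinuousOn (traceInvP α A) {C | 0 ≤ C} := by
  refine continuous_trace_re.comp_continuousOn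
    ((continuousOn_const.mul ((continuousOn_rpow_of_pos (sub_pos.2 hα)).comp
      (f := fun C => A ^ (1 / 2 : ℝ) * C * A ^ (1 / 2 : ℝ)) ?_ ?_)).mul continuousOn_const)
  · exact (continuousOn_const.mul continuousOn_id).mul continuousOn_const
  · exact fun C hC => (CFC.rpow_nonneg (a := A)).isSelfAdjoint.conjugate_nonneg hC

lemma continuousOn_traceInvQ (hα : 1 < α) (hz : 0 < z) (A : Matrix (Fin n) (Fin n) ℂ) :
    ContinuousOn (traceInvQ α z A) {C | 0 ≤ C} := by
  have hc : 0 < (α - 1) / (2 * z) := div_pos (sub_pos.2 hα) (by positivity)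
  refine continuous_trace_re.comp_continuousOn ((continuousOn_rpow_of_pos hz).comp
    (f := fun C => C ^ ((α - 1) / (2 * z)) * A ^ (α / z) * C ^ ((α - 1) / (2 * z))) ?_ ?_)
  · exact ((continuousOn_rpow_of_pos hc).mul continuousOn_const).mul (continuousOn_rpow_of_pos hc)
  · exact fun C _ => (CFC.rpow_nonneg (a := C)).isSelfAdjoint.conjugate_nonneg CFC.rpow_nonneg

lemma posDef_rpow (hC : C.PosDef) (s : ℝ) : (C ^ s).PosDef := by
  rw [← Matrix.isStrictlyPositive_iff_posDef] at *
  exact hC.rpow C s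

/-- A singular `C` corresponds to no `B`, so the inequality is carried there by continuity in `C`.
-/
lemma traceInvP_le_traceInvQ (hα : 1 < α) (hz : 0 < z) (hA : A.PosDef) (hC : C.PosSemidef)
    (h : ∀ B : Matrix (Fin n) (Fin n) ℂ, B.PosDef → (P α A B).trace.re ≤ (Q α z A B).trace.re) :
    traceInvP α A C ≤ traceInvQ α z A C := by
  refine le_of_le_posDef (continuousOn_traceInvP hα A) (continuousOn_traceInvQ hα hz A)
    (fun C hC => ?_) hC
  rw [← trace_P_rpow_neg_one hA hC, ← trace_Q_rpow_neg_one hC]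
  exact h _ (posDef_rpow hC _)

lemma traceInvQ_le_traceInvP (hα : 1 < α) (hz : 0 < z) (hA : A.PosDef) (hC : C.PosSemidef)
    (h : ∀ B : Matrix (Fin n) (Fin n) ℂ, B.PosDef → (Q α z A B).trace.re ≤ (P α A B).trace.re) :
    traceInvQ α z A C ≤ traceInvP α A C := by
  refine le_of_le_posDef (continuousOn_traceInvQ hα hz A) (continuousOn_traceInvP hα A)
    (fun C hC => ?_) hC
  rw [← trace_P_rpow_neg_one hA hC, ← trace_Q_rpow_neg_one hC]
  exact h _ (posDef_rpow hC _)

lemma traceInvP_rankOne (hα : 1 < α) {p a : Fin n → ℝ} (hp : ∀ i, 0 ≤ p i) (ha : ∀ i, 0 < a i) :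
    traceInvP α (realDiagonal a) (rankOne p) =
      (∑ i, p i * a i) ^ (α - 2) * ∑ i, p i * (a i * a i) := by
  have e : ∀ i, a i ^ (1 / 2 : ℝ) * a i ^ (1 / 2 : ℝ) = a i := fun i => by
    rw [← Real.rpow_add (ha i), add_halves, Real.rpow_one]
  have h := realDiagonal_conj_rankOne_rpow hp (fun i => a i ^ (1 / 2 : ℝ)) (sub_pos.2 hα)
  simp only [e] at h
  rw [traceInvP, realDiagonal_rpow fun i => (ha i).le, h, mul_smul_comm, smul_mul_assoc,
    Matrix.trace_smul, Complex.smul_re, smul_eq_mul, show α - 1 - 1 = α - 2 by ring]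
  congr 1
  have h2 : realDiagonal (fun i => a i ^ (1 / 2 : ℝ)) * realDiagonal (fun i => a i ^ (1 / 2 : ℝ)) =
      realDiagonal a := by simp only [realDiagonal_mul_realDiagonal, e]
  rw [← trace_realDiagonal_conj_rankOne hp, ← h2]
  congr 2
  noncomm_ring

lemma traceInvQ_rankOne (hα : 1 < α) (hz : 0 < z) {p a : Fin n → ℝ} (hp : ∀ i, 0 ≤ p i)
    (hsum : ∑ i, p i = 1) (ha : ∀ i, 0 < a i) :
    traceInvQ α z (realDiagonal a) (rankOne p) = (∑ i, p i * a i ^ (α / z)) ^ z := by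
  rw [traceInvQ, rankOne_rpow hp hsum (div_pos (sub_pos.2 hα) (by positivity)),
    realDiagonal_rpow fun i => (ha i).le, rankOne_mul_realDiagonal_mul_rankOne hp]
  set m := ∑ i, p i * a i ^ (α / z) with hm
  have hm0 : 0 ≤ m := Finset.sum_nonneg fun i _ => mul_nonneg (hp i) (Real.rpow_nonneg (ha i).le _)
  have h1 : rankOne p * rankOne p = rankOne p := by
    have h := rankOne_mul_realDiagonal_mul_rankOne hp fun _ => 1
    rwa [realDiagonal_one, mul_one, Finset.sum_congr rfl fun i _ => mul_one (p i), hsum,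
      one_smul] at h
  rw [rpow_of_mul_self_eq_smul (m := m) (smul_nonneg hm0 (posSemidef_rankOne p).nonneg)
    (by rw [smul_mul_smul_comm, h1, smul_smul]) hz, Matrix.trace_smul, Matrix.trace_smul,
    Complex.smul_re, Complex.smul_re, trace_rankOne hp hsum, smul_eq_mul, smul_eq_mul, mul_one]
  rcases hm0.eq_or_lt with h0 | h0
  · rw [← h0, mul_zero, Real.zero_rpow hz.ne']
  · nth_rw 2 [← Real.rpow_one m]
    rw [← Real.rpow_add h0, sub_add_cancel]

end InverseContinuity

/-! ### Scalar asymptotics that force the bounds on `z`. -/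

section ScalarLimits

open Filter Topology

/-- `Tr P_α` for a two-point spectrum `{t, 1}` with weights `q, 1 - q`. -/
noncomputable def twoPointP (α q t : ℝ) : ℝ :=
  (q * t + (1 - q)) ^ (α - 2) * (q * (t * t) + (1 - q))

/-- `Tr Q_{α,z}` for a two-point spectrum `{t, 1}` with weights `q, 1 - q`. -/
noncomputable def twoPointQ (α z q t : ℝ) : ℝ := (q * t ^ (α / z) + (1 - q)) ^ z

variable {α z : ℝ}

lemma tendsto_twoPointP_zero (α : ℝ) :
    Tendsto (twoPointP α (1 / 2)) (𝓝[>] 0) (𝓝 ((1 / 2) ^ (α - 1))) := by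
  have h : ContinuousAt (twoPointP α (1 / 2)) 0 := by
    -- The base equals `1/2` at `t = 0`, so a negative exponent `α - 2` does no harm.
    refine ContinuousAt.mul (ContinuousAt.rpow_const (by fun_prop) (Or.inl (by norm_num)))
      (by fun_prop)
  have e : twoPointP α (1 / 2) 0 = (1 / 2) ^ (α - 1) := by
    rw [twoPointP, show α - 1 = (α - 2) + 1 by ring, Real.rpow_add_one (by norm_num)]
    norm_num
  rw [← e]
  exact h.tendsto.mono_left nhdsWithin_le_nhds

lemma tendsto_twoPointQ_zero (hα : 0 < α) (hz : 0 < z) :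
    Tendsto (twoPointQ α z (1 / 2)) (𝓝[>] 0) (𝓝 ((1 / 2) ^ z)) := by
  have hαz : 0 < α / z := div_pos hα hz
  have h : ContinuousAt (twoPointQ α z (1 / 2)) 0 := by
    refine ContinuousAt.rpow_const ?_ (Or.inr hz.le)
    exact (continuousAt_const.mul (Real.continuousAt_rpow_const 0 _ (Or.inr hαz.le))).add
      continuousAt_const
  have e : twoPointQ α z (1 / 2) 0 = (1 / 2) ^ z := by
    rw [twoPointQ, Real.zero_rpow hαz.ne']
    norm_num
  rw [← e]
  exact h.tendsto.mono_left nhdsWithin_le_nhds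

lemma le_sub_one_of_twoPointP_le (hα : 0 < α) (hz : 0 < z)
    (h : ∀ t, 0 < t → twoPointP α (1 / 2) t ≤ twoPointQ α z (1 / 2) t) : z ≤ α - 1 := by
  have h1 := le_of_tendsto_of_tendsto (tendsto_twoPointP_zero α) (tendsto_twoPointQ_zero hα hz)
    (by filter_upwards [self_mem_nhdsWithin] with t ht using h t ht)
  exact (Real.rpow_le_rpow_left_iff_of_base_lt_one (by norm_num) (by norm_num)).1 h1

lemma sub_one_le_of_twoPointQ_le (hα : 0 < α) (hz : 0 < z)
    (h : ∀ t, 0 < t → twoPointQ α z (1 / 2) t ≤ twoPointP α (1 / 2) t) : α - 1 ≤ z := by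
  have h1 := le_of_tendsto_of_tendsto (tendsto_twoPointQ_zero hα hz) (tendsto_twoPointP_zero α)
    (by filter_upwards [self_mem_nhdsWithin] with t ht using h t ht)
  exact (Real.rpow_le_rpow_left_iff_of_base_lt_one (by norm_num) (by norm_num)).1 h1

lemma tendsto_weighted_rpow {s r : ℝ} (hs : 0 < s) (hrs : r < s) :
    Tendsto (fun t : ℝ => t ^ (-s) * t ^ r + (1 - t ^ (-s))) atTop (𝓝 1) := by
  have h1 : Tendsto (fun t : ℝ => t ^ (-(s - r)) + (1 - t ^ (-s))) atTop (𝓝 (0 + (1 - 0))) :=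
    (tendsto_rpow_neg_atTop (sub_pos.2 hrs)).add
      (tendsto_const_nhds.sub (tendsto_rpow_neg_atTop hs))
  rw [sub_zero, zero_add] at h1
  refine h1.congr' ?_
  filter_upwards [eventually_gt_atTop 0] with t ht
  rw [← Real.rpow_add ht]
  ring_nf

lemma tendsto_weighted_rpow_atTop {s r : ℝ} (hs : 0 < s) (hsr : s < r) :
    Tendsto (fun t : ℝ => t ^ (-s) * t ^ r + (1 - t ^ (-s))) atTop atTop := by
  have h1 : Tendsto (fun t : ℝ => t ^ (r - s) + (1 - t ^ (-s))) atTop atTop :=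
    (tendsto_rpow_atTop (sub_pos.2 hsr)).atTop_add
      (tendsto_const_nhds.sub (tendsto_rpow_neg_atTop hs))
  refine h1.congr' ?_
  filter_upwards [eventually_gt_atTop 0] with t ht
  rw [← Real.rpow_add ht]
  ring_nf

lemma twoPointP_rpow_neg (α s : ℝ) {t : ℝ} : twoPointP α (t ^ (-s)) t =
    (t ^ (-s) * t ^ (1 : ℝ) + (1 - t ^ (-s))) ^ (α - 2) *
      (t ^ (-s) * t ^ (2 : ℝ) + (1 - t ^ (-s))) := by
  rw [twoPointP, Real.rpow_one, Real.rpow_two, sq]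

lemma tendsto_twoPointP_one {s : ℝ} (hs : 2 < s) :
    Tendsto (fun t : ℝ => twoPointP α (t ^ (-s)) t) atTop (𝓝 1) := by
  simp_rw [twoPointP_rpow_neg]
  have h1 := ((tendsto_weighted_rpow (s := s) (r := 1) (by linarith) (by linarith)).rpow_const
    (p := α - 2) (Or.inl one_ne_zero)).mul
    (tendsto_weighted_rpow (s := s) (r := 2) (by linarith) hs)
  simpa using h1

lemma tendsto_twoPointP_atTop {s : ℝ} (hs : 1 < s) (hs2 : s < 2) :
    Tendsto (fun t : ℝ => twoPointP α (t ^ (-s)) t) atTop atTop := by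
  simp_rw [twoPointP_rpow_neg]
  have h1 := (tendsto_weighted_rpow (s := s) (r := 1) (by linarith) hs).rpow_const
    (p := α - 2) (Or.inl one_ne_zero)
  rw [Real.one_rpow] at h1
  exact h1.pos_mul_atTop one_pos (tendsto_weighted_rpow_atTop (by linarith) hs2)

lemma le_half_of_twoPointP_le (hz : 0 < z)
    (h : ∀ q t, 0 ≤ q → q ≤ 1 → 0 < t → twoPointP α q t ≤ twoPointQ α z q t) : z ≤ α / 2 := by
  by_contra! hlt
  have h2 : α / z < 2 := by rw [div_lt_iff₀ hz]; linarith
  -- With weight `q = t ^ (-s)` a moment of order `r` tends to `1` if `r < s` and to `∞` if `r > s`.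
  -- Choosing `s` above `1` and `α / z` but below `2` makes only the second moment, hence only `P`,
  -- blow up.
  obtain ⟨s, hs1, hs2⟩ := exists_between (max_lt (show (1 : ℝ) < 2 by norm_num) h2)
  rw [max_lt_iff] at hs1
  have hQ : Tendsto (fun t : ℝ => twoPointQ α z (t ^ (-s)) t) atTop (𝓝 1) := by
    have h1 := (tendsto_weighted_rpow (by linarith) hs1.2).rpow_const (p := z) (Or.inr hz.le)
    rwa [Real.one_rpow] at h1
  refine not_tendsto_nhds_of_tendsto_atTop
    (tendsto_atTop_mono' atTop ?_ (tendsto_twoPointP_atTop (α := α) hs1.1 hs2)) 1 hQ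
  filter_upwards [eventually_ge_atTop 1] with t ht
  exact h _ _ (by positivity) (Real.rpow_le_one_of_one_le_of_nonpos ht (by linarith))
    (by linarith)

lemma half_le_of_twoPointQ_le (hz : 0 < z)
    (h : ∀ q t, 0 ≤ q → q ≤ 1 → 0 < t → twoPointQ α z q t ≤ twoPointP α q t) : α / 2 ≤ z := by
  by_contra! hlt
  have h2 : 2 < α / z := by rw [lt_div_iff₀ hz]; linarith
  -- Now `s` lies above `2` and below `α / z`, so `Q` blows up while `P` tends to `1`.
  obtain ⟨s, hs1, hs2⟩ := exists_between h2
  have hQ : Tendsto (fun t : ℝ => twoPointQ α z (t ^ (-s)) t) atTop atTop :=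
    (tendsto_rpow_atTop hz).comp (tendsto_weighted_rpow_atTop (by linarith) hs2)
  refine not_tendsto_nhds_of_tendsto_atTop
    (tendsto_atTop_mono' atTop ?_ hQ) 1 (tendsto_twoPointP_one (α := α) hs1)
  filter_upwards [eventually_ge_atTop 1] with t ht
  exact h _ _ (by positivity) (Real.rpow_le_one_of_one_le_of_nonpos ht (by linarith))
    (by linarith)

lemma exists_rpow_sub_one_lt (hα1 : α < 1) (z : ℝ) :
    ∃ b : ℝ, 0 < b ∧ (1 / 2 * b⁻¹ + 1 / 2) ^ (α - 1) < (1 / 2 : ℝ) ^ z := by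
  have h1 : Tendsto (fun t : ℝ => 1 / 2 * t + 1 / 2) atTop atTop :=
    tendsto_atTop_add_const_right _ _ (tendsto_id.const_mul_atTop (by norm_num))
  have h2 : Tendsto (fun t : ℝ => (1 / 2 * t + 1 / 2) ^ (-(1 - α))) atTop (𝓝 0) :=
    (tendsto_rpow_neg_atTop (sub_pos.2 hα1)).comp h1
  obtain ⟨t, ht, ht0⟩ := ((h2.eventually_lt_const
    (Real.rpow_pos_of_pos (show (0 : ℝ) < 1 / 2 by norm_num) z)).and (eventually_gt_atTop 0)).exists
  refine ⟨t⁻¹, inv_pos.2 ht0, ?_⟩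
  rwa [inv_inv, show α - 1 = -(1 - α) by ring]

end ScalarLimits

/-! ### Two-dimensional counterexamples. -/

section Necessity

variable {α z : ℝ}

lemma traceInvP_twoPoint (hα : 1 < α) {q t : ℝ} (hq0 : 0 ≤ q) (hq1 : q ≤ 1) (ht : 0 < t) :
    traceInvP α (realDiagonal ![t, 1]) (rankOne ![q, 1 - q]) = twoPointP α q t := by
  rw [traceInvP_rankOne hα (by simp [Fin.forall_fin_two, hq0, hq1])
    (by simp [Fin.forall_fin_two, ht])]
  simp [Fin.sum_univ_two, twoPointP]

lemma traceInvQ_twoPoint (hα : 1 < α) (hz : 0 < z) {q t : ℝ} (hq0 : 0 ≤ q) (hq1 : q ≤ 1)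
    (ht : 0 < t) :
    traceInvQ α z (realDiagonal ![t, 1]) (rankOne ![q, 1 - q]) = twoPointQ α z q t := by
  rw [traceInvQ_rankOne hα hz (by simp [Fin.forall_fin_two, hq0, hq1])
    (by simp [Fin.sum_univ_two]) (by simp [Fin.forall_fin_two, ht])]
  simp [Fin.sum_univ_two, twoPointQ]

lemma posDef_twoPoint {t : ℝ} (ht : 0 < t) : (realDiagonal ![t, 1]).PosDef :=
  posDef_realDiagonal (by simp [Fin.forall_fin_two, ht])

lemma le_min_of_trace_P_le (hα : 1 < α) (hz : 0 < z)
    (h : ∀ A B : Matrix (Fin 2) (Fin 2) ℂ, A.PosDef → B.PosDef →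
      (P α A B).trace.re ≤ (Q α z A B).trace.re) : z ≤ min (α / 2) (α - 1) := by
  have key : ∀ q t, 0 ≤ q → q ≤ 1 → 0 < t → twoPointP α q t ≤ twoPointQ α z q t := by
    intro q t hq0 hq1 ht
    rw [← traceInvP_twoPoint hα hq0 hq1 ht, ← traceInvQ_twoPoint hα hz hq0 hq1 ht]
    exact traceInvP_le_traceInvQ hα hz (posDef_twoPoint ht) (posSemidef_rankOne _)
      fun B hB => h _ B (posDef_twoPoint ht) hB
  exact le_min (le_half_of_twoPointP_le hz key) (le_sub_one_of_twoPointP_le (by linarith) hz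
    fun t ht => key _ t (by norm_num) (by norm_num) ht)

lemma max_le_of_trace_Q_le (hα : 1 < α) (hz : 0 < z)
    (h : ∀ A B : Matrix (Fin 2) (Fin 2) ℂ, A.PosDef → B.PosDef →
      (Q α z A B).trace.re ≤ (P α A B).trace.re) : max (α / 2) (α - 1) ≤ z := by
  have key : ∀ q t, 0 ≤ q → q ≤ 1 → 0 < t → twoPointQ α z q t ≤ twoPointP α q t := by
    intro q t hq0 hq1 ht
    rw [← traceInvP_twoPoint hα hq0 hq1 ht, ← traceInvQ_twoPoint hα hz hq0 hq1 ht]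
    exact traceInvQ_le_traceInvP hα hz (posDef_twoPoint ht) (posSemidef_rankOne _)
      fun B hB => h _ B (posDef_twoPoint ht) hB
  exact max_le (half_le_of_twoPointQ_le hz key) (sub_one_le_of_twoPointQ_le (by linarith) hz
    fun t ht => key _ t (by norm_num) (by norm_num) ht)

lemma exists_trace_P_lt_trace_Q (hα : 0 < α) (hα1 : α < 1) (hz : 0 < z) :
    ∃ A B : Matrix (Fin 2) (Fin 2) ℂ, A.PosSemidef ∧ A ≠ 0 ∧ B.PosDef ∧
      (P α A B).trace.re < (Q α z A B).trace.re := by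
  obtain ⟨b, hb, hlt⟩ := exists_rpow_sub_one_lt hα1 z
  have hp : ∀ i, 0 ≤ (![1 / 2, 1 / 2] : Fin 2 → ℝ) i := by simp [Fin.forall_fin_two]
  have hsum : ∑ i, (![1 / 2, 1 / 2] : Fin 2 → ℝ) i = 1 := by norm_num [Fin.sum_univ_two]
  have hb' : ∀ i, 0 < (![b, 1] : Fin 2 → ℝ) i := by simp [Fin.forall_fin_two, hb]
  refine ⟨rankOne ![1 / 2, 1 / 2], realDiagonal ![b, 1], posSemidef_rankOne _,
    rankOne_ne_zero hp hsum, posDef_realDiagonal hb', ?_⟩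
  rw [trace_P_rankOne hp hsum hb' hα, trace_Q_rankOne hp hsum hb' hα hz]
  simp only [Fin.sum_univ_two, Matrix.cons_val_zero, Matrix.cons_val_one, inv_one, mul_one,
    Real.one_rpow]
  -- The base in the trace of `Q` is at least `1/2`, whatever `b` is, whereas small `b` drives the
  -- trace of `P` to `0`.
  refine hlt.trans_le (Real.rpow_le_rpow (by norm_num) ?_ hz.le)
  have := Real.rpow_nonneg hb.le ((1 - α) / z)
  linarith

end Necessity

end RenyiComparison

open RenyiComparison

theorem corollary8p1 (α z : ℝ) (hα : 0 < α) (hα1 : α ≠ 1) (hz : 0 < z) :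
    ((∀ (n : ℕ) (A B : Matrix (Fin n) (Fin n) ℂ), A.PosSemidef → A ≠ 0 → B.PosDef →
        RenyiComparison.maximalDiv α A B ≤ RenyiComparison.alphaZDiv α z A B) ↔
      (1 < α ∧ z ≤ min (α / 2) (α - 1))) ∧
    ((∀ (n : ℕ) (A B : Matrix (Fin n) (Fin n) ℂ), A.PosSemidef → A ≠ 0 → B.PosDef →
        RenyiComparison.alphaZDiv α z A B ≤ RenyiComparison.maximalDiv α A B) ↔
      (α < 1 ∨ (1 < α ∧ max (α / 2) (α - 1) ≤ z))) := by
  have hPcont : ∀ {n : ℕ} (B : Matrix (Fin n) (Fin n) ℂ),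
      ContinuousOn (fun A => (P α A B).trace.re) {A | 0 ≤ A} := fun B =>
    continuous_trace_re.comp_continuousOn (continuousOn_P hα B)
  have hQcont : ∀ {n : ℕ} (B : Matrix (Fin n) (Fin n) ℂ),
      ContinuousOn (fun A => (Q α z A B).trace.re) {A | 0 ≤ A} := fun B =>
    continuous_trace_re.comp_continuousOn (continuousOn_Q hα hz B)
  have hne : ∀ {A : Matrix (Fin 2) (Fin 2) ℂ}, A.PosDef → A ≠ 0 := fun hA => hA.isUnit.ne_zero
  refine ⟨⟨fun h => ?_, ?_⟩, ⟨fun h => ?_, ?_⟩⟩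
  · rcases hα1.lt_or_gt with h1 | h1
    · obtain ⟨A, B, hA, h0, hB, hlt⟩ := exists_trace_P_lt_trace_Q hα h1 hz
      exact absurd ((maximalDiv_le_alphaZDiv_iff_of_lt_one hα h1 hz hA h0 hB).1 (h 2 A B hA h0 hB))
        hlt.not_ge
    · exact ⟨h1, le_min_of_trace_P_le h1 hz fun A B hA hB =>
        (maximalDiv_le_alphaZDiv_iff h1 hz hA.posSemidef (hne hA) hB).1
          (h 2 A B hA.posSemidef (hne hA) hB)⟩
  · rintro ⟨h1, hle⟩ n A B hA h0 hB
    exact (maximalDiv_le_alphaZDiv_iff h1 hz hA h0 hB).2 (le_of_le_posDef (hPcont B) (hQcont B)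
      (fun A hA => trace_P_le_trace_Q_of_le_min h1 hz hle hA hB) hA)
  · rcases hα1.lt_or_gt with h1 | h1
    · exact Or.inl h1
    · exact Or.inr ⟨h1, max_le_of_trace_Q_le h1 hz fun A B hA hB =>
        (alphaZDiv_le_maximalDiv_iff h1 hz hA.posSemidef (hne hA) hB).1
          (h 2 A B hA.posSemidef (hne hA) hB)⟩
  · rintro (h1 | ⟨h1, hle⟩) n A B hA h0 hB
    · exact (alphaZDiv_le_maximalDiv_iff_of_lt_one hα h1 hz hA h0 hB).2
        (le_of_le_posDef (hPcont B) (hQcont B)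
          (fun A hA => trace_P_le_trace_Q_of_lt_one hα h1 hz hA hB) hA)
    · exact (alphaZDiv_le_maximalDiv_iff h1 hz hA h0 hB).2
        (le_of_le_posDef (hQcont B) (hPcont B)
          (fun A hA => trace_Q_le_trace_P_of_max_le h1 hle hA hB) hA)
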